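/- Let $n\ge 1$ and let $\Omega\subset\mathbb{R}^n$ be a nonempty bounded open convex set with $C^\infty$ boundary and outward unit normal $\nu$. Write $\Delta_\infty\varphi=\sum_{i,j=1}^n\varphi_{x_i}\varphi_{x_ix_j}\varphi_{x_j}$, and for $\Lambda\ge 0$ consider the Neumann eigenvalue problem for the $\infty$-Laplacian $$ \begin{cases} \min\{|\nabla u|-\Lambda |u|,\,-\Delta_\infty u\}=0 & \text{in }\{u>0\}\cap\Omega,\\ \max\{\Lambda |u|-|\nabla u|,\,-\Delta_\infty u\}=0 & \text{in }\{u<0\}\cap\Omega,\\ -\Delta_\infty u=0 & \text{in }\{u=0\}\cap\Omega,\\ \dfrac{\partial u}{\partial\nu}=0 & \text{on }\partial\Omega. \end{cases}\tag{P} $$ Solutions are understood in the viscosity sense. For $\varphi$ of class $C^2$ and a point $x_0$ let $E_{x_0}[\varphi]$ denote, at $x_0$, the quantity $\min\{|\nabla\varphi|-\Lambda|\varphi|,-\Delta_\infty\varphi\}$ if $u(x_0)>0$, the quantity $\max\{\Lambda|\varphi|-|\nabla\varphi|,-\Delta_\infty\varphi\}$ if $u(x_0)<0$, and $-\Delta_\infty\varphi$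 if $u(x_0)=0$. A continuous function $u:\overline\Omega\to\mathbb{R}$ is a viscosity solution of (P) if the following hold. (a) For all $x_0\in\Omega$ and $\varphi\in C^2(\Omega)$ with $\varphi(x_0)=u(x_0)$: if $u<\varphi$ on $\Omega\setminus\{x_0\}$, then $E_{x_0}[\varphi]\le 0$; if $u>\varphi$ on $\Omega\setminus\{x_0\}$, then $E_{x_0}[\varphi]\ge 0$. (b) For all $x_0\in\partial\Omega$ and $\varphi\in C^2(\overline\Omega)$ with $\varphi(x_0)=u(x_0)$: if $u<\varphi$ on $\overline\Omega\setminus\{x_0\}$, then $\min\{E_{x_0}[\varphi],\frac{\partial\varphi}{\partial\nu}(x_0)\}\le 0$; if $u>\varphi$ on $\overline\Omega\setminus\{x_0\}$, then $\max\{E_{x_0}[\varphi],\frac{\partial\varphi}{\partial\nu}(x_0)\}\ge 0$. Then: 1. If, for some $\Lambda\ge 0$, problem (P) has a nonconstant continuous viscosity solution, then $$\Lambda\ \ge\ \frac{2}{\operatorname{diam}(\Omega)}.$$ 2. For $\Lambda=\frac{2}{\operatorname{diam}(\Omega)}$, problem (P) has a nonconstant viscosity solution that is Lipschitz continuous on $\overline\Omega$.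 -/

import Mathlib

open scoped ContDiff

namespace NeumannInfty

noncomputable section

/-- `ρ` is a smooth local defining function of `Ω` near `x`: on some open neighbourhood `U` of `x`,
`ρ` is `C^∞`, `Ω ∩ U = {ρ < 0} ∩ U`, and moreover `ρ x = 0`, `∇ρ x ≠ 0`. -/
def IsLocalDefiningFunction {n : ℕ} (Ω : Set (EuclideanSpace ℝ (Fin n)))
    (x : EuclideanSpace ℝ (Fin n)) (ρ : EuclideanSpace ℝ (Fin n) → ℝ) : Prop :=
  ∃ U : Set (EuclideanSpace ℝ (Fin n)), IsOpen U ∧ x ∈ U ∧ ContDiffOn ℝ ∞ ρ U ∧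
    (∀ y ∈ U, y ∈ Ω ↔ ρ y < 0) ∧ ρ x = 0 ∧ gradient ρ x ≠ 0

/-- `Ω` has smooth boundary: near each boundary point it lies on one side of a smooth
hypersurface. -/
def HasSmoothBoundary {n : ℕ} (Ω : Set (EuclideanSpace ℝ (Fin n))) : Prop :=
  ∀ x ∈ frontier Ω, ∃ ρ, IsLocalDefiningFunction Ω x ρ

/-- `ν` is the outward unit normal `∇ρ / |∇ρ|` to `Ω` at `x` (independent of the choice of `ρ`). -/
def IsOutwardUnitNormal {n : ℕ} (Ω : Set (EuclideanSpace ℝ (Fin n)))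
    (x ν : EuclideanSpace ℝ (Fin n)) : Prop :=
  ∃ ρ, IsLocalDefiningFunction Ω x ρ ∧ ν = ‖gradient ρ x‖⁻¹ • gradient ρ x

/-- `Δ_∞ φ (x) = ∑ i j, φ_i φ_ij φ_j = D²φ(x)(∇φ(x), ∇φ(x))`, with all derivatives taken within `S`.
For `S` open these are the usual derivatives; for `S` the closure of a convex open set and
`φ` in `C²(S)` they are the continuous extensions to `S` of the derivatives in the interior. -/
def inftyLaplacianWithin {n : ℕ} (S : Set (EuclideanSpace ℝ (Fin n)))
    (φ : EuclideanSpace ℝ (Fin n) → ℝ) (x : EuclideanSpace ℝ (Fin n)) : ℝ :=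
  fderivWithin ℝ (fderivWithin ℝ φ S) S x (gradientWithin φ S x) (gradientWithin φ S x)

/-- `F = min {|∇φ| - Λ|φ|, -Δ_∞ φ}` at `x`. -/
def opF {n : ℕ} (Λ : ℝ) (S : Set (EuclideanSpace ℝ (Fin n)))
    (φ : EuclideanSpace ℝ (Fin n) → ℝ) (x : EuclideanSpace ℝ (Fin n)) : ℝ :=
  min (‖gradientWithin φ S x‖ - Λ * |φ x|) (-inftyLaplacianWithin S φ x)

/-- `G = max {Λ|φ| - |∇φ|, -Δ_∞ φ}` at `x`. -/
def opG {n : ℕ} (Λ : ℝ) (S : Set (EuclideanSpace ℝ (Fin n)))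
    (φ : EuclideanSpace ℝ (Fin n) → ℝ) (x : EuclideanSpace ℝ (Fin n)) : ℝ :=
  max (Λ * |φ x| - ‖gradientWithin φ S x‖) (-inftyLaplacianWithin S φ x)

/-- `H = -Δ_∞ φ` at `x`. -/
def opH {n : ℕ} (S : Set (EuclideanSpace ℝ (Fin n)))
    (φ : EuclideanSpace ℝ (Fin n) → ℝ) (x : EuclideanSpace ℝ (Fin n)) : ℝ :=
  -inftyLaplacianWithin S φ x

/-- `φ ∈ C²(S)` touches `u` strictly from above on `S` at `x₀`. -/
def TouchesAbove {n : ℕ} (S : Set (EuclideanSpace ℝ (Fin n)))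
    (u φ : EuclideanSpace ℝ (Fin n) → ℝ) (x₀ : EuclideanSpace ℝ (Fin n)) : Prop :=
  ContDiffOn ℝ 2 φ S ∧ u x₀ = φ x₀ ∧ ∀ x ∈ S, x ≠ x₀ → u x < φ x

/-- `φ ∈ C²(S)` touches `u` strictly from below on `S` at `x₀`. -/
def TouchesBelow {n : ℕ} (S : Set (EuclideanSpace ℝ (Fin n)))
    (u φ : EuclideanSpace ℝ (Fin n) → ℝ) (x₀ : EuclideanSpace ℝ (Fin n)) : Prop :=
  ContDiffOn ℝ 2 φ S ∧ u x₀ = φ x₀ ∧ ∀ x ∈ S, x ≠ x₀ → φ x < u x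

/-- Viscosity subsolution of the Neumann `∞`-eigenvalue problem on `Ω` with parameter `Λ`;
`u` is a function on the closure of `Ω` (its values elsewhere play no role). -/
structure IsViscositySubsolution {n : ℕ} (Ω : Set (EuclideanSpace ℝ (Fin n))) (Λ : ℝ)
    (u : EuclideanSpace ℝ (Fin n) → ℝ) : Prop where
  usc : UpperSemicontinuousOn u (closure Ω)
  interior : ∀ x₀ ∈ Ω, ∀ φ : EuclideanSpace ℝ (Fin n) → ℝ, TouchesAbove Ω u φ x₀ →
    (0 < u x₀ → opF Λ Ω φ x₀ ≤ 0) ∧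
    (u x₀ < 0 → opG Λ Ω φ x₀ ≤ 0) ∧
    (u x₀ = 0 → opH Ω φ x₀ ≤ 0)
  boundary : ∀ x₀ ∈ frontier Ω, ∀ ν, IsOutwardUnitNormal Ω x₀ ν →
    ∀ φ : EuclideanSpace ℝ (Fin n) → ℝ, TouchesAbove (closure Ω) u φ x₀ →
    (0 < u x₀ →
      min (opF Λ (closure Ω) φ x₀) (inner ℝ (gradientWithin φ (closure Ω) x₀) ν) ≤ 0) ∧
    (u x₀ < 0 →
      min (opG Λ (closure Ω) φ x₀) (inner ℝ (gradientWithin φ (closure Ω) x₀) ν) ≤ 0) ∧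
    (u x₀ = 0 →
      min (opH (closure Ω) φ x₀) (inner ℝ (gradientWithin φ (closure Ω) x₀) ν) ≤ 0)

/-- Viscosity supersolution of the Neumann `∞`-eigenvalue problem on `Ω` with parameter `Λ`. -/
structure IsViscositySupersolution {n : ℕ} (Ω : Set (EuclideanSpace ℝ (Fin n))) (Λ : ℝ)
    (u : EuclideanSpace ℝ (Fin n) → ℝ) : Prop where
  lsc : LowerSemicontinuousOn u (closure Ω)
  interior : ∀ x₀ ∈ Ω, ∀ φ : EuclideanSpace ℝ (Fin n) → ℝ, TouchesBelow Ω u φ x₀ →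
    (0 < u x₀ → 0 ≤ opF Λ Ω φ x₀) ∧
    (u x₀ < 0 → 0 ≤ opG Λ Ω φ x₀) ∧
    (u x₀ = 0 → 0 ≤ opH Ω φ x₀)
  boundary : ∀ x₀ ∈ frontier Ω, ∀ ν, IsOutwardUnitNormal Ω x₀ ν →
    ∀ φ : EuclideanSpace ℝ (Fin n) → ℝ, TouchesBelow (closure Ω) u φ x₀ →
    (0 < u x₀ →
      0 ≤ max (opF Λ (closure Ω) φ x₀) (inner ℝ (gradientWithin φ (closure Ω) x₀) ν)) ∧
    (u x₀ < 0 →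
      0 ≤ max (opG Λ (closure Ω) φ x₀) (inner ℝ (gradientWithin φ (closure Ω) x₀) ν)) ∧
    (u x₀ = 0 →
      0 ≤ max (opH (closure Ω) φ x₀) (inner ℝ (gradientWithin φ (closure Ω) x₀) ν))

/-- Continuous viscosity solution of the Neumann `∞`-eigenvalue problem. -/
structure IsViscositySolution {n : ℕ} (Ω : Set (EuclideanSpace ℝ (Fin n))) (Λ : ℝ)
    (u : EuclideanSpace ℝ (Fin n) → ℝ) : Prop where
  continuousOn : ContinuousOn u (closure Ω)
  sub : IsViscositySubsolution Ω Λ u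
  super : IsViscositySupersolution Ω Λ u

/-- `u` is not constant on `Ω`. -/
def NonconstantOn {n : ℕ} (Ω : Set (EuclideanSpace ℝ (Fin n)))
    (u : EuclideanSpace ℝ (Fin n) → ℝ) : Prop :=
  ∃ x ∈ Ω, ∃ y ∈ Ω, u x ≠ u y

end

end NeumannInfty

/-! Everything rests on one cone estimate (`le_add_mul_norm_of_subAt`): a subsolution bounded above
by `M ≥ 0` satisfies `v x ≤ v z + Λ M |x - z|`. Otherwise a cone with vertex `z ∈ Ω` and slope
slightly above `Λ M`, bent to be strictly `∞`-superharmonic, can be shifted vertically to touch `v`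
from above at some `m ≠ z`. There its gradient norm exceeds `Λ v m` and `-Δ_∞` is positive, so the
equation fails. The Neumann alternative fails too: the gradient is a positive multiple of `m - z`,
which by convexity points out of `Ω`.

Lower bound: let `p`, `q` be a maximum and a minimum point of `u`. The estimate for `u` and for `-u`
bounds `u p - u q` by `Λ diam Ω` times the positive part of `u p` and of `-u q` respectively. Hence
both numbers are positive, and comparing their sum with twice the smaller one gives `2 ≤ Λ diam Ω`.

Existence: take `a`, `b` in the closure at distance `diam Ω`, and let `P` be the supremum of the
functions between the cone `1 - Λ|x - a|` and `1` that equal `-1` at `b` and are subsolutions away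
from `b`. The cone estimate with `M = 1` makes all of them Λ-Lipschitz, so `P` is again one of them.
Maximality makes `-P` a subsolution, because a violation would allow a local bump (`exists_bump`).
The points where bumping is forbidden, `b` and `{P = 1}`, are handled by cones from `b`
(`subAt_of_peak`, `subAt_of_antipodal`).

The boundary condition is encoded by `Outgoing`: only test functions whose gradient points out of
`Ω` are tested. In the interior this is no restriction, and on the boundary it means a positive
normal derivative, so `SubAt` treats both cases at once. -/

namespace NeumannInfty

open Set Filter Topology Metric

variable {n : ℕ} {Ω S : Set (EuclideanSpace ℝ (Fin n))} {Λ : ℝ}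
  {x y a b : EuclideanSpace ℝ (Fin n)} {u v w f g φ ψ : EuclideanSpace ℝ (Fin n) → ℝ}

/-! ### The combined operator -/

/-- The value of the operator in the problem for a test function with value `r`, gradient norm `g`
and `-Δ_∞` equal to `h`. -/
noncomputable def signedOp (Λ r g h : ℝ) : ℝ :=
  if 0 < r then min (g - Λ * |r|) h else if r < 0 then max (Λ * |r| - g) h else h

lemma signedOp_of_pos {r : ℝ} (hr : 0 < r) (Λ g h : ℝ) :
    signedOp Λ r g h = min (g - Λ * |r|) h := by
  simp [signedOp, hr]

lemma signedOp_of_neg {r : ℝ} (hr : r < 0) (Λ g h : ℝ) :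
    signedOp Λ r g h = max (Λ * |r| - g) h := by
  simp [signedOp, hr, hr.le.not_gt]

lemma signedOp_zero (Λ g h : ℝ) : signedOp Λ 0 g h = h := by
  simp [signedOp]

lemma signedOp_neg (Λ r g h : ℝ) : signedOp Λ (-r) g (-h) = -signedOp Λ r g h := by
  rcases lt_trichotomy r 0 with hr | rfl | hr
  · rw [signedOp_of_pos (neg_pos.2 hr), signedOp_of_neg hr, abs_neg, ← min_neg_neg, neg_sub]
  · simp [signedOp_zero]
  · rw [signedOp_of_neg (neg_lt_zero.2 hr), signedOp_of_pos hr, abs_neg, ← max_neg_neg, neg_sub]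

lemma signedOp_mono (Λ r g : ℝ) {h h' : ℝ} (hh : h ≤ h') :
    signedOp Λ r g h ≤ signedOp Λ r g h' := by
  rcases lt_trichotomy r 0 with hr | rfl | hr
  · simpa only [signedOp_of_neg hr] using max_le_max_left _ hh
  · simpa only [signedOp_zero] using hh
  · simpa only [signedOp_of_pos hr] using min_le_min_left _ hh

lemma signedOp_pos {r g h : ℝ} (hh : 0 < h) (hg : 0 < r → Λ * r < g) : 0 < signedOp Λ r g h := by
  rcases lt_trichotomy r 0 with hr | rfl | hr
  · rw [signedOp_of_neg hr]; exact lt_max_of_lt_right hh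
  · rwa [signedOp_zero]
  · rw [signedOp_of_pos hr, abs_of_pos hr]; exact lt_min (sub_pos.2 (hg hr)) hh

/-- Positivity of the operator is an open condition, provided that `h` vanishes with `g`. -/
lemma eventually_signedOp_pos {α : Type*} {l : Filter α} {R G H : α → ℝ} {r g h : ℝ}
    (hR : Tendsto R l (𝓝 r)) (hG : Tendsto G l (𝓝 g)) (hH : Tendsto H l (𝓝 h))
    (hg : 0 ≤ g) (hgh : g = 0 → h = 0) (hpos : 0 < signedOp Λ r g h) :
    ∀ᶠ i in l, 0 < signedOp Λ (R i) (G i) (H i) := by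
  rcases lt_trichotomy r 0 with hr | rfl | hr
  · rw [signedOp_of_neg hr] at hpos
    filter_upwards [hR.eventually_lt_const hr,
      (((hR.abs.const_mul Λ).sub hG).max hH).eventually_const_lt hpos] with i hi hi'
    rwa [signedOp_of_neg hi]
  · rw [signedOp_zero] at hpos
    -- At `r = 0` only `h` is constrained, but nearby positive values bring in the gradient term; `h
    -- ≠ 0` forces `g > 0`, which keeps that term positive.
    have hg' : Λ * 0 < g := by
      rw [mul_zero]
      exact lt_of_le_of_ne hg fun e => hpos.ne' (hgh e.symm)
    filter_upwards [(hR.const_mul Λ).eventually_lt hG hg', hH.eventually_const_lt hpos]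
      with i hi hi'
    exact signedOp_pos hi' fun _ => hi
  · rw [signedOp_of_pos hr] at hpos
    filter_upwards [hR.eventually_const_lt hr,
      ((hG.sub (hR.abs.const_mul Λ)).min hH).eventually_const_lt hpos] with i hi hi'
    rwa [signedOp_of_pos hi]

/-! ### Outgoing vectors and normals -/

/-- The vector `p` points out of `Ω` at `x`: some point `x - t p` with `t > 0` lies in `Ω`. -/
def Outgoing (Ω : Set (EuclideanSpace ℝ (Fin n))) (x p : EuclideanSpace ℝ (Fin n)) : Prop :=
  ∃ t : ℝ, 0 < t ∧ x - t • p ∈ Ω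

lemma outgoing_of_mem (hΩ : IsOpen Ω) (hx : x ∈ Ω) (p : EuclideanSpace ℝ (Fin n)) :
    Outgoing Ω x p := by
  have hc : Tendsto (fun t : ℝ => x - t • p) (𝓝[>] 0) (𝓝 x) := by
    have : ContinuousAt (fun t : ℝ => x - t • p) 0 := by fun_prop
    simpa [ContinuousAt] using this.tendsto.mono_left nhdsWithin_le_nhds
  obtain ⟨t, ht, ht0⟩ := ((hc.eventually (hΩ.mem_nhds hx)).and self_mem_nhdsWithin).exists
  exact ⟨t, ht0, ht⟩

lemma Outgoing.eventually_nhdsWithin {G : EuclideanSpace ℝ (Fin n) → EuclideanSpace ℝ (Fin n)}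
    {S : Set (EuclideanSpace ℝ (Fin n))} (hΩ : IsOpen Ω) (h : Outgoing Ω x (G x))
    (hG : ContinuousWithinAt G S x) : ∀ᶠ y in 𝓝[S] x, Outgoing Ω y (G y) := by
  obtain ⟨t, ht, hx⟩ := h
  have : ContinuousWithinAt (fun y => y - t • G y) S x :=
    continuousWithinAt_id.sub (hG.const_smul t)
  filter_upwards [this.eventually (hΩ.mem_nhds hx)] with y hy
  exact ⟨t, ht, hy⟩

lemma Outgoing.eventually_mem (hc : Convex ℝ Ω) (hx : x ∈ closure Ω)
    {p : EuclideanSpace ℝ (Fin n)} (h : Outgoing Ω x p) :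
    ∀ᶠ t : ℝ in 𝓝[>] 0, x + t • (-p) ∈ closure Ω := by
  obtain ⟨t, ht, hxt⟩ := h
  filter_upwards [Ioc_mem_nhdsGT ht] with s hs
  have := hc.closure.add_smul_mem (y := -(t • p)) hx
    (by rw [← sub_eq_add_neg]; exact subset_closure hxt) (t := s / t)
    ⟨div_nonneg hs.1.le ht.le, (div_le_one ht).2 hs.2⟩
  rwa [← smul_neg, smul_smul, div_mul_cancel₀ _ ht.ne'] at this

lemma IsOutwardUnitNormal.norm_eq_one {ν : EuclideanSpace ℝ (Fin n)}
    (h : IsOutwardUnitNormal Ω x ν) : ‖ν‖ = 1 := by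
  obtain ⟨ρ, ⟨U, -, -, -, -, -, hne⟩, rfl⟩ := h
  rw [norm_smul, norm_inv, norm_norm, inv_mul_cancel₀ (norm_ne_zero_iff.2 hne)]

lemma IsOutwardUnitNormal.notMem {ν : EuclideanSpace ℝ (Fin n)}
    (h : IsOutwardUnitNormal Ω x ν) : x ∉ Ω := by
  obtain ⟨ρ, ⟨U, -, hxU, -, hΩU, h0, -⟩, -⟩ := h
  rw [hΩU x hxU, h0]
  exact lt_irrefl _

/-- The defining function vanishes at `x` and has negative derivative along `-p`, so it is negative
at `x - t p` for small `t > 0`. -/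
lemma IsOutwardUnitNormal.outgoing {ν p : EuclideanSpace ℝ (Fin n)}
    (h : IsOutwardUnitNormal Ω x ν) (hp : 0 < inner ℝ p ν) : Outgoing Ω x p := by
  obtain ⟨ρ, ⟨U, hU, hxU, hρ, hΩU, h0, hne⟩, rfl⟩ := h
  have hd : DifferentiableAt ℝ ρ x :=
    (hρ.contDiffAt (hU.mem_nhds hxU)).differentiableAt (by simp)
  have hpos : 0 < inner ℝ (gradient ρ x) p := by
    rw [inner_smul_right, real_inner_comm] at hp
    exact pos_of_mul_pos_right hp (by positivity)
  rw [inner_gradient_left] at hpos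
  have hline : HasDerivAt (fun t : ℝ => x - t • p) (-p) 0 := by
    simpa using ((hasDerivAt_id (0 : ℝ)).smul_const p).const_sub x
  have hder : HasDerivAt (fun t : ℝ => ρ (x - t • p)) (-(fderiv ℝ ρ x p)) 0 := by
    have hd' : HasFDerivAt ρ (fderiv ℝ ρ x) (x - (0 : ℝ) • p) := by simpa using hd.hasFDerivAt
    have h1 := hd'.comp_hasDerivAt (0 : ℝ) hline
    rw [map_neg] at h1
    exact h1
  have hs := hder.tendsto_slope_zero_right
  have hmem : ∀ᶠ t : ℝ in 𝓝[>] 0, x - t • p ∈ U := by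
    refine (hline.continuousAt.tendsto.mono_left nhdsWithin_le_nhds).eventually
      (hU.mem_nhds (by simpa using hxU))
  obtain ⟨t, ⟨ht1, ht2⟩, ht0⟩ :=
    (((hs.eventually_lt_const (neg_lt_zero.2 hpos)).and hmem).and self_mem_nhdsWithin).exists
  refine ⟨t, ht0, (hΩU _ ht2).2 ?_⟩
  have ht0' : (0 : ℝ) < t := ht0
  simp only [zero_add, zero_smul, sub_zero, h0, smul_eq_mul] at ht1
  exact neg_of_mul_neg_right ht1 (inv_nonneg.2 ht0'.le)

/-- An outward normal of a convex open set defines a strictly supporting hyperplane. -/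
lemma IsOutwardUnitNormal.inner_sub_neg {ν z : EuclideanSpace ℝ (Fin n)}
    (h : IsOutwardUnitNormal Ω x ν) (hΩ : IsOpen Ω) (hc : Convex ℝ Ω) (hz : z ∈ Ω) :
    inner ℝ (z - x) ν < 0 := by
  -- Otherwise `x` would lie on a segment between `w` and a point `x - t (w - x)` of `Ω`, hence in
  -- `Ω`.
  have key : ∀ w ∈ Ω, ¬ 0 < inner ℝ (w - x) ν := by
    intro w hw hpos
    obtain ⟨t, ht, hxt⟩ := h.outgoing hpos
    refine h.notMem ?_
    have := hc hxt hw (a := 1 / (1 + t)) (b := t / (1 + t)) (by positivity) (by positivity)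
      (by field_simp)
    convert this using 1
    match_scalars <;> field_simp <;> ring
  -- Moving `z` slightly along `ν` stays in `Ω` and increases the inner product, so the weak
  -- inequality becomes strict.
  obtain ⟨t, ht, hzt⟩ := outgoing_of_mem hΩ hz (-ν)
  have h1 := not_lt.1 (key _ hzt)
  have h2 : z - t • -ν - x = (z - x) + t • ν := by module
  rw [h2, inner_add_left, inner_smul_left, real_inner_self_eq_norm_sq, h.norm_eq_one] at h1
  simp at h1
  linarith

lemma IsOutwardUnitNormal.inner_pos_of_outgoing {ν p : EuclideanSpace ℝ (Fin n)}
    (h : IsOutwardUnitNormal Ω x ν) (hΩ : IsOpen Ω) (hc : Convex ℝ Ω) (hp : Outgoing Ω x p) :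
    0 < inner ℝ p ν := by
  obtain ⟨t, ht, hxt⟩ := hp
  have := h.inner_sub_neg hΩ hc hxt
  rw [sub_sub_cancel_left, inner_neg_left, inner_smul_left, neg_lt_zero] at this
  exact pos_of_mul_pos_right this ht.le

lemma HasSmoothBoundary.exists_normal (h : HasSmoothBoundary Ω) (hx : x ∈ frontier Ω) :
    ∃ ν, IsOutwardUnitNormal Ω x ν := by
  obtain ⟨ρ, hρ⟩ := h x hx
  exact ⟨_, ρ, hρ, rfl⟩

lemma uniqueDiffOn_closure (hΩ : IsOpen Ω) (hc : Convex ℝ Ω) (hne : Ω.Nonempty) :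
    UniqueDiffOn ℝ (closure Ω) :=
  uniqueDiffOn_convex hc.closure (hne.mono (interior_maximal subset_closure hΩ))

/-! ### First and second order conditions -/

lemma le_fderivWithin_of_eventually_le {f : EuclideanSpace ℝ (Fin n) → ℝ}
    {S : Set (EuclideanSpace ℝ (Fin n))} {e : EuclideanSpace ℝ (Fin n)} {c : ℝ}
    (hf : DifferentiableWithinAt ℝ f S x) (hS : ∀ᶠ t : ℝ in 𝓝[>] 0, x + t • e ∈ S)
    (h : ∀ᶠ t : ℝ in 𝓝[>] 0, f x + t * c ≤ f (x + t • e)) : c ≤ fderivWithin ℝ f S x e := by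
  have hlim : Tendsto (fun t : ℝ => t • e) (𝓝[>] 0) (𝓝 0) := by
    have : ContinuousAt (fun t : ℝ => t • e) 0 := by fun_prop
    simpa [ContinuousAt] using this.tendsto.mono_left nhdsWithin_le_nhds
  have := hf.hasFDerivWithinAt.lim (c := fun t : ℝ => t⁻¹) (v := e) hlim hS
    (tendsto_const_nhds.congr' (by
      filter_upwards [self_mem_nhdsWithin] with t ht
      rw [smul_smul, inv_mul_cancel₀ (ne_of_gt ht), one_smul]))
  refine ge_of_tendsto this ?_
  filter_upwards [h, self_mem_nhdsWithin] with t ht ht0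
  rw [smul_eq_mul, le_inv_mul_iff₀ ht0]
  linarith

lemma tendsto_add_smul_nhdsWithin {S : Set (EuclideanSpace ℝ (Fin n))}
    {e : EuclideanSpace ℝ (Fin n)} (hS : ∀ᶠ t : ℝ in 𝓝[>] 0, x + t • e ∈ S) :
    Tendsto (fun t : ℝ => x + t • e) (𝓝[>] 0) (𝓝[S] x) := by
  have : ContinuousAt (fun t : ℝ => x + t • e) 0 := by fun_prop
  exact tendsto_nhdsWithin_iff.2
    ⟨by simpa [ContinuousAt] using this.tendsto.mono_left nhdsWithin_le_nhds, hS⟩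

lemma hasDerivAt_fderiv_line {f : EuclideanSpace ℝ (Fin n) → ℝ} (hf : ContDiffAt ℝ 2 f x)
    (p : EuclideanSpace ℝ (Fin n)) :
    HasDerivAt (fun t : ℝ => fderiv ℝ f (x + t • p) p) (fderiv ℝ (fderiv ℝ f) x p p) 0 := by
  have hd : DifferentiableAt ℝ (fderiv ℝ f) x :=
    (hf.fderiv_right (m := 1) (by norm_num)).differentiableAt (by simp)
  have hline : HasDerivAt (fun t : ℝ => x + t • p) p 0 := by
    simpa using ((hasDerivAt_id (0 : ℝ)).smul_const p).const_add x
  have hd' : HasFDerivAt (fderiv ℝ f) (fderiv ℝ (fderiv ℝ f) x) (x + (0 : ℝ) • p) := by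
    simpa using hd.hasFDerivAt
  have h1 : HasDerivAt (fun t : ℝ => fderiv ℝ f (x + t • p)) (fderiv ℝ (fderiv ℝ f) x p) 0 :=
    hd'.comp_hasDerivAt (0 : ℝ) hline
  exact (ContinuousLinearMap.apply ℝ ℝ p).hasFDerivAt.comp_hasDerivAt (0 : ℝ) h1

lemma eventually_hasDerivAt_line {f : EuclideanSpace ℝ (Fin n) → ℝ} (hf : ContDiffAt ℝ 2 f x)
    (p : EuclideanSpace ℝ (Fin n)) :
    ∀ᶠ t : ℝ in 𝓝 0, HasDerivAt (fun s : ℝ => f (x + s • p)) (fderiv ℝ f (x + t • p) p) t := by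
  have hc : Tendsto (fun t : ℝ => x + t • p) (𝓝 0) (𝓝 x) := by
    have : ContinuousAt (fun t : ℝ => x + t • p) 0 := by fun_prop
    simpa [ContinuousAt] using this
  filter_upwards [hc.eventually (hf.eventually (by simp))] with t ht
  have hline : HasDerivAt (fun t : ℝ => x + t • p) p t := by
    simpa using ((hasDerivAt_id t).smul_const p).const_add x
  exact (ht.differentiableAt (by simp)).hasFDerivAt.comp_hasDerivAt t hline

/-- A negative second derivative along `p` would make `0` a local maximum of the restriction to the
line as well. The restriction would then be locally constant, with vanishing second derivative. -/
lemma _root_.IsLocalMin.fderiv_fderiv_nonneg {f : EuclideanSpace ℝ (Fin n) → ℝ}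
    (h : IsLocalMin f x) (hf : ContDiffAt ℝ 2 f x) (p : EuclideanSpace ℝ (Fin n)) :
    0 ≤ fderiv ℝ (fderiv ℝ f) x p p := by
  by_contra! hneg
  set g : ℝ → ℝ := fun t => f (x + t • p) with hg
  have hc : Tendsto (fun t : ℝ => x + t • p) (𝓝 0) (𝓝 x) := by
    have : ContinuousAt (fun t : ℝ => x + t • p) 0 := by fun_prop
    simpa [ContinuousAt] using this
  have hev := eventually_hasDerivAt_line hf p
  have hd1 : deriv g =ᶠ[𝓝 0] fun t => fderiv ℝ f (x + t • p) p := hev.mono fun t ht => ht.deriv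
  have hd2 : deriv (deriv g) 0 = fderiv ℝ (fderiv ℝ f) x p p := by
    rw [hd1.deriv_eq, (hasDerivAt_fderiv_line hf p).deriv]
  have hd0 : deriv g 0 = 0 := by
    have : deriv g 0 = fderiv ℝ f (x + (0 : ℝ) • p) p := hd1.self_of_nhds
    rw [this, zero_smul, add_zero, h.fderiv_eq_zero]; rfl
  have hmax : IsLocalMax g 0 :=
    isLocalMax_of_deriv_deriv_neg (hd2.trans_lt hneg) hd0 hev.self_of_nhds.continuousAt
  have hconst : g =ᶠ[𝓝 0] fun _ => g 0 := by
    filter_upwards [hmax, hc.eventually h] with t h1 h2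
    refine le_antisymm h1 ?_
    simpa [hg] using h2
  have : deriv (deriv g) 0 = 0 := by
    rw [hconst.deriv.deriv_eq]; simp
  exact hneg.ne (hd2.symm.trans this)

/-! ### Calculus of derivatives within a set -/

lemma gradientWithin_eq_gradient (hS : UniqueDiffOn ℝ S) (hx : x ∈ S)
    (hφ : ContDiffAt ℝ 2 φ x) : gradientWithin φ S x = gradient φ x := by
  rw [gradientWithin, gradient, (hφ.differentiableAt (by simp)).fderivWithin (hS x hx)]

lemma inftyLaplacianWithin_eq (hS : UniqueDiffOn ℝ S) (hx : x ∈ S) (hφ : ContDiffAt ℝ 2 φ x) :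
    inftyLaplacianWithin S φ x = fderiv ℝ (fderiv ℝ φ) x (gradient φ x) (gradient φ x) := by
  have h1 : fderivWithin ℝ φ S =ᶠ[𝓝[S] x] fderiv ℝ φ := by
    filter_upwards [nhdsWithin_le_nhds (hφ.eventually (by simp)), self_mem_nhdsWithin] with y hy hyS
    exact (hy.differentiableAt (by simp)).fderivWithin (hS y hyS)
  have hd : DifferentiableAt ℝ (fderiv ℝ φ) x :=
    (hφ.fderiv_right (m := 1) (by norm_num)).differentiableAt (by simp)
  rw [inftyLaplacianWithin, gradientWithin_eq_gradient hS hx hφ, h1.fderivWithin_eq_of_mem hx,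
    hd.fderivWithin (hS x hx)]

lemma gradientWithin_congr (h : f =ᶠ[𝓝[S] x] g) (hx : x ∈ S) :
    gradientWithin f S x = gradientWithin g S x := by
  rw [gradientWithin, gradientWithin, h.fderivWithin_eq_of_mem hx]

lemma inftyLaplacianWithin_congr (h : f =ᶠ[𝓝[S] x] g) (hx : x ∈ S) :
    inftyLaplacianWithin S f x = inftyLaplacianWithin S g x := by
  rw [inftyLaplacianWithin, inftyLaplacianWithin, gradientWithin_congr h hx,
    h.fderivWithin.fderivWithin_eq_of_mem hx]

lemma gradientWithin_add_const (f : EuclideanSpace ℝ (Fin n) → ℝ) (c : ℝ) :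
    gradientWithin (fun y => f y + c) S x = gradientWithin f S x := by
  rw [gradientWithin, gradientWithin, fderivWithin_add_const]

lemma inftyLaplacianWithin_add_const (f : EuclideanSpace ℝ (Fin n) → ℝ) (c : ℝ) :
    inftyLaplacianWithin S (fun y => f y + c) x = inftyLaplacianWithin S f x := by
  have : fderivWithin ℝ (fun y => f y + c) S = fderivWithin ℝ f S := by
    ext1 y; exact fderivWithin_add_const c
  rw [inftyLaplacianWithin, inftyLaplacianWithin, gradientWithin_add_const, this]

lemma gradientWithin_const_sub (hS : UniqueDiffOn ℝ S) (hx : x ∈ S)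
    (f : EuclideanSpace ℝ (Fin n) → ℝ) (c : ℝ) :
    gradientWithin (fun y => c - f y) S x = -gradientWithin f S x := by
  rw [gradientWithin, gradientWithin, fderivWithin_const_sub (hS x hx), map_neg]

lemma inftyLaplacianWithin_const_sub (hS : UniqueDiffOn ℝ S) (hx : x ∈ S)
    (f : EuclideanSpace ℝ (Fin n) → ℝ) (c : ℝ) :
    inftyLaplacianWithin S (fun y => c - f y) x = -inftyLaplacianWithin S f x := by
  have h1 : fderivWithin ℝ (fun y => c - f y) S =ᶠ[𝓝[S] x] -fderivWithin ℝ f S := by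
    filter_upwards [self_mem_nhdsWithin] with y hy
    exact fderivWithin_const_sub (hS y hy) c
  rw [inftyLaplacianWithin, inftyLaplacianWithin, gradientWithin_const_sub hS hx,
    h1.fderivWithin_eq_of_mem hx, fderivWithin_neg (hS x hx)]
  simp

lemma continuousWithinAt_gradientWithin (hS : UniqueDiffOn ℝ S) (hx : x ∈ S)
    (hφ : ContDiffWithinAt ℝ 2 φ S x) : ContinuousWithinAt (gradientWithin φ S) S x :=
  (InnerProductSpace.toDual ℝ (EuclideanSpace ℝ (Fin n))).symm.continuous.continuousAt
    |>.comp_continuousWithinAt (hφ.fderivWithin_right (m := 1) hS (by norm_num) hx).continuousWithinAt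

lemma continuousWithinAt_inftyLaplacianWithin (hS : UniqueDiffOn ℝ S) (hx : x ∈ S)
    (hφ : ContDiffWithinAt ℝ 2 φ S x) : ContinuousWithinAt (inftyLaplacianWithin S φ) S x := by
  have h1 := hφ.fderivWithin_right (m := 1) hS (by norm_num) hx
  have h2 := (h1.fderivWithin_right (m := 0) hS (by norm_num) hx).continuousWithinAt
  have h3 := continuousWithinAt_gradientWithin hS hx hφ
  exact (h2.clm_apply h3).clm_apply h3

lemma contDiff_norm_sub_pow_four (a : EuclideanSpace ℝ (Fin n)) :
    ContDiff ℝ 2 fun y => ‖y - a‖ ^ 4 := by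
  have : (fun y : EuclideanSpace ℝ (Fin n) => ‖y - a‖ ^ 4) = fun y => (‖y - a‖ ^ 2) ^ 2 := by
    ext y; ring
  rw [this]
  exact ((contDiff_id.sub contDiff_const).norm_sq ℝ).pow 2

lemma fderiv_norm_sub_pow_four (a y : EuclideanSpace ℝ (Fin n)) :
    fderiv ℝ (fun y => ‖y - a‖ ^ 4) y = (4 * ‖y - a‖ ^ 2) • innerSL ℝ (y - a) := by
  have h0 : (fun y : EuclideanSpace ℝ (Fin n) => ‖y - a‖ ^ 4) = fun y => (‖y - a‖ ^ 2) ^ 2 := by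
    ext y; ring
  have h1 : HasFDerivAt (fun y : EuclideanSpace ℝ (Fin n) => ‖y - a‖ ^ 2)
      (2 • (innerSL ℝ (y - a)).comp (ContinuousLinearMap.id ℝ _)) y :=
    ((hasFDerivAt_id y).sub_const a).norm_sq
  rw [h0, (h1.pow 2).fderiv]
  ext v
  simp
  ring

lemma fderiv_fderiv_norm_sub_pow_four (a : EuclideanSpace ℝ (Fin n)) :
    fderiv ℝ (fderiv ℝ (fun y => ‖y - a‖ ^ 4)) a = 0 := by
  have : fderiv ℝ (fun y : EuclideanSpace ℝ (Fin n) => ‖y - a‖ ^ 4) =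
      fun y => (4 * ‖y - a‖ ^ 2) • innerSL ℝ (y - a) := funext fun y => fderiv_norm_sub_pow_four a y
  rw [this]
  have h1 : HasFDerivAt (fun y : EuclideanSpace ℝ (Fin n) => ‖y - a‖ ^ 2)
      (2 • (innerSL ℝ (a - a)).comp (ContinuousLinearMap.id ℝ _)) a :=
    ((hasFDerivAt_id a).sub_const a).norm_sq
  have h2 : HasFDerivAt (fun y : EuclideanSpace ℝ (Fin n) => innerSL ℝ (y - a)) (innerSL ℝ) a :=
    (innerSL ℝ).hasFDerivAt.comp a ((hasFDerivAt_id a).sub_const a)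
  refine ((h1.const_mul 4).smul h2).fderiv.trans ?_
  ext v w
  simp

lemma fderivWithin_add_quartic (hS : UniqueDiffOn ℝ S) (hx : x ∈ S)
    (hφ : ContDiffWithinAt ℝ 2 φ S x) :
    fderivWithin ℝ (fun y => φ y + ‖y - a‖ ^ 4) S x =
      fderivWithin ℝ φ S x + fderiv ℝ (fun y => ‖y - a‖ ^ 4) x := by
  have hq : DifferentiableAt ℝ (fun y : EuclideanSpace ℝ (Fin n) => ‖y - a‖ ^ 4) x :=
    (contDiff_norm_sub_pow_four a).differentiable (by simp) x
  rw [fderivWithin_fun_add (hS x hx) (hφ.differentiableWithinAt (by simp))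
    hq.differentiableWithinAt, hq.fderivWithin (hS x hx)]

/-- Adding `‖y - x‖ ^ 4` makes a touching strict and changes no derivative at `x` up to order 2. -/
lemma gradientWithin_add_quartic (hS : UniqueDiffOn ℝ S) (hx : x ∈ S)
    (hφ : ContDiffWithinAt ℝ 2 φ S x) :
    gradientWithin (fun y => φ y + ‖y - x‖ ^ 4) S x = gradientWithin φ S x := by
  rw [gradientWithin, gradientWithin, fderivWithin_add_quartic hS hx hφ, fderiv_norm_sub_pow_four]
  simp

lemma inftyLaplacianWithin_add_quartic (hS : UniqueDiffOn ℝ S) (hx : x ∈ S)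
    (hφ : ContDiffWithinAt ℝ 2 φ S x) :
    inftyLaplacianWithin S (fun y => φ y + ‖y - x‖ ^ 4) x = inftyLaplacianWithin S φ x := by
  have h1 : fderivWithin ℝ (fun y => φ y + ‖y - x‖ ^ 4) S =ᶠ[𝓝[S] x]
      fun y => fderivWithin ℝ φ S y + fderiv ℝ (fun y => ‖y - x‖ ^ 4) y := by
    have hev := hφ.eventually (by simp)
    rw [insert_eq_of_mem hx] at hev
    filter_upwards [hev, self_mem_nhdsWithin] with y hy hyS
    exact fderivWithin_add_quartic hS hyS hy
  have hq : DifferentiableAt ℝ (fderiv ℝ (fun y : EuclideanSpace ℝ (Fin n) => ‖y - x‖ ^ 4)) x :=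
    ((contDiff_norm_sub_pow_four x).contDiffAt.fderiv_right (m := 1)
      (by norm_num)).differentiableAt (by simp)
  have hφ' : DifferentiableWithinAt ℝ (fderivWithin ℝ φ S) S x :=
    (hφ.fderivWithin_right (m := 1) hS (by norm_num) hx).differentiableWithinAt (by simp)
  rw [inftyLaplacianWithin, inftyLaplacianWithin, gradientWithin_add_quartic hS hx hφ,
    h1.fderivWithin_eq_of_mem hx, fderivWithin_fun_add (hS x hx) hφ' hq.differentiableWithinAt,
    hq.fderivWithin (hS x hx), fderiv_fderiv_norm_sub_pow_four, add_zero]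

/-! ### Radial functions -/

/-- With `δ > 0` this is the bent cone, with `-Δ_∞ = 2δ(k - 2δr)²`; with `δ = 0` it is the cone
itself, which is `∞`-harmonic off its vertex. -/
lemma contDiffAt_radial (c k δ : ℝ) (hx : x ≠ a) :
    ContDiffAt ℝ 2 (fun y => c + k * ‖y - a‖ - δ * ‖y - a‖ ^ 2) x := by
  have h1 : ContDiffAt ℝ 2 (fun y => y - a) x := contDiffAt_id.sub contDiffAt_const
  have h2 := h1.norm ℝ (sub_ne_zero.2 hx)
  exact (contDiffAt_const.add (contDiffAt_const.mul h2)).sub (contDiffAt_const.mul (h2.pow 2))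

lemma gradient_radial (c k δ : ℝ) (hx : x ≠ a) :
    gradient (fun y => c + k * ‖y - a‖ - δ * ‖y - a‖ ^ 2) x =
      (k / ‖x - a‖ - 2 * δ) • (x - a) := by
  have h1 : HasFDerivAt (fun y : EuclideanSpace ℝ (Fin n) => ‖y - a‖ ^ 2)
      (2 • (innerSL ℝ (x - a)).comp (ContinuousLinearMap.id ℝ _)) x :=
    ((hasFDerivAt_id x).sub_const a).norm_sq
  have hr : 0 < ‖x - a‖ := norm_pos_iff.2 (sub_ne_zero.2 hx)
  have h2 := h1.sqrt (by positivity)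
  simp only [Real.sqrt_sq (norm_nonneg _)] at h2
  have h3 := ((h2.const_mul k).const_add c).sub (h1.const_mul δ)
  refine HasGradientAt.gradient ?_
  rw [hasGradientAt_iff_hasFDerivAt]
  refine h3.congr_fderiv ?_
  ext v
  simp
  field_simp

lemma norm_gradient_radial (c k δ : ℝ) (hx : x ≠ a) :
    ‖gradient (fun y => c + k * ‖y - a‖ - δ * ‖y - a‖ ^ 2) x‖ = |k - 2 * δ * ‖x - a‖| := by
  have hr : 0 < ‖x - a‖ := norm_pos_iff.2 (sub_ne_zero.2 hx)
  rw [gradient_radial c k δ hx, norm_smul, Real.norm_eq_abs, ← abs_of_pos hr, ← abs_mul,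
    abs_of_pos hr, sub_mul, div_mul_cancel₀ _ hr.ne']

/-- The gradient is radial, so the `∞`-Laplacian needs only this second derivative along the line
through `a`, where the function is a quadratic polynomial near `x`. -/
lemma fderiv_fderiv_radial (c k δ s : ℝ) (hx : x ≠ a) :
    fderiv ℝ (fderiv ℝ (fun y => c + k * ‖y - a‖ - δ * ‖y - a‖ ^ 2)) x (s • (x - a)) (s • (x - a)) =
      -(2 * δ) * (s * ‖x - a‖) ^ 2 := by
  have hr : 0 < ‖x - a‖ := norm_pos_iff.2 (sub_ne_zero.2 hx)
  refine (hasDerivAt_fderiv_line (contDiffAt_radial c k δ hx) (s • (x - a))).unique ?_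
  have hpos : ∀ᶠ t : ℝ in 𝓝 0, 0 < 1 + t * s := by
    have : ContinuousAt (fun t : ℝ => 1 + t * s) 0 := by fun_prop
    exact this.eventually (lt_mem_nhds (by simp))
  have hev : (fun t : ℝ => fderiv ℝ (fun y => c + k * ‖y - a‖ - δ * ‖y - a‖ ^ 2)
      (x + t • s • (x - a)) (s • (x - a))) =ᶠ[𝓝 0]
      fun t => k * s * ‖x - a‖ - 2 * δ * (1 + t * s) * s * ‖x - a‖ ^ 2 := by
    filter_upwards [hpos] with t ht
    have e1 : x + t • s • (x - a) - a = (1 + t * s) • (x - a) := by module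
    have hne : x + t • s • (x - a) ≠ a := by
      rw [← sub_ne_zero, e1]
      exact smul_ne_zero ht.ne' (sub_ne_zero.2 hx)
    rw [← inner_gradient_left, gradient_radial c k δ hne, e1, norm_smul, Real.norm_eq_abs,
      abs_of_pos ht]
    simp only [inner_smul_left, inner_smul_right, real_inner_self_eq_norm_sq]
    simp only [conj_trivial]
    have ht' : 1 + s * t ≠ 0 := by rw [mul_comm s t]; exact ht.ne'
    field_simp
  refine HasDerivAt.congr_of_eventuallyEq ?_ hev
  have h0 : HasDerivAt (fun t : ℝ => 1 + t * s) s 0 := by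
    simpa using ((hasDerivAt_id (0 : ℝ)).mul_const s).const_add 1
  have h1 := (((h0.const_mul (2 * δ)).mul_const s).mul_const (‖x - a‖ ^ 2)).const_sub
    (k * s * ‖x - a‖)
  refine h1.congr_deriv ?_
  ring

lemma inftyLaplacian_radial (c k δ : ℝ) (hx : x ≠ a) :
    fderiv ℝ (fderiv ℝ (fun y => c + k * ‖y - a‖ - δ * ‖y - a‖ ^ 2)) x
      (gradient (fun y => c + k * ‖y - a‖ - δ * ‖y - a‖ ^ 2) x)
      (gradient (fun y => c + k * ‖y - a‖ - δ * ‖y - a‖ ^ 2) x) =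
      -(2 * δ) * (k - 2 * δ * ‖x - a‖) ^ 2 := by
  have hr : 0 < ‖x - a‖ := norm_pos_iff.2 (sub_ne_zero.2 hx)
  rw [gradient_radial c k δ hx, fderiv_fderiv_radial c k δ _ hx, sub_mul, div_mul_cancel₀ _ hr.ne']

/-! ### Comparison of touching functions -/

/-- If `η` touches `ψ` from above at `x`, the gradient of `η` points out of `Ω` and that of `ψ` does
not, then `x` is an interior point at which the gradients agree. -/
lemma gradientWithin_eq_of_touch (hΩ : IsOpen Ω) (hc : Convex ℝ Ω) (hx : x ∈ closure Ω)
    {η : EuclideanSpace ℝ (Fin n) → ℝ} (hη : DifferentiableWithinAt ℝ η (closure Ω) x)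
    (hψ : DifferentiableWithinAt ℝ ψ (closure Ω) x) (hU : UniqueDiffOn ℝ (closure Ω))
    (heq : ψ x = η x) (hle : ∀ᶠ y in 𝓝[closure Ω] x, ψ y ≤ η y)
    (hout : Outgoing Ω x (gradientWithin η (closure Ω) x))
    (hin : ∃ s : ℝ, 0 < s ∧ x + s • gradientWithin ψ (closure Ω) x ∈ closure Ω) :
    x ∈ Ω ∧ gradientWithin η (closure Ω) x = gradientWithin ψ (closure Ω) x := by
  set p := gradientWithin η (closure Ω) x with hp
  set q := gradientWithin ψ (closure Ω) x with hq
  -- `η - ψ` has a local minimum on the closure at `x`, so its derivative is nonnegative in every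
  -- admissible direction. Both `-p` and `q` are admissible, and adding the two inequalities gives
  -- `-|p - q|² ≥ 0`.
  have key : ∀ e, (∀ᶠ t : ℝ in 𝓝[>] 0, x + t • e ∈ closure Ω) → 0 ≤ inner ℝ (p - q) e := by
    intro e he
    have h1 := le_fderivWithin_of_eventually_le (c := 0) (hη.sub hψ) he (by
      filter_upwards [(tendsto_add_smul_nhdsWithin he).eventually hle] with t ht
      simp only [Pi.sub_apply, heq]
      linarith)
    rw [fderivWithin_sub (hU x hx) hη hψ] at h1
    rwa [inner_sub_left, hp, hq, inner_gradientWithin_left, inner_gradientWithin_left]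
  have h1 := key (-p) (hout.eventually_mem hc hx)
  have h2 := key q (by
    obtain ⟨s, hs, hxs⟩ := hin
    filter_upwards [Ioc_mem_nhdsGT hs] with t ht
    have := hc.closure.add_smul_mem hx hxs (t := t / s)
      ⟨div_nonneg ht.1.le hs.le, (div_le_one hs).2 ht.2⟩
    rwa [smul_smul, div_mul_cancel₀ _ hs.ne'] at this)
  have h3 : inner ℝ (p - q) (p - q) ≤ 0 := by
    have : inner ℝ (p - q) (p - q) = -(inner ℝ (p - q) (-p) + inner ℝ (p - q) q) := by
      rw [inner_sub_right, inner_neg_right]; ring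
    linarith
  have hpq : p = q := by
    rw [← sub_eq_zero]
    exact inner_self_eq_zero.1 (le_antisymm h3 real_inner_self_nonneg)
  refine ⟨?_, hpq⟩
  -- Since `p = q`, the point `x` lies strictly between `x - t p ∈ Ω` and `x + s p` in the closure,
  -- hence in the interior.
  obtain ⟨t, ht, hxt⟩ := hout
  obtain ⟨s, hs, hxs⟩ := hin
  rw [← hpq] at hxs
  have := hc.combo_interior_closure_mem_interior (hΩ.interior_eq.symm ▸ hxt) hxs
    (a := s / (s + t)) (b := t / (s + t)) (by positivity) (by positivity) (by field_simp)
  rw [hΩ.interior_eq] at this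
  convert this using 1
  match_scalars <;> field_simp
  ring

lemma inftyLaplacianWithin_le_of_touch (hΩ : IsOpen Ω) (hx : x ∈ Ω)
    (hU : UniqueDiffOn ℝ (closure Ω)) {η : EuclideanSpace ℝ (Fin n) → ℝ}
    (hη : ContDiffWithinAt ℝ 2 η (closure Ω) x) (hψ : ContDiffWithinAt ℝ 2 ψ (closure Ω) x)
    (heq : ψ x = η x) (hle : ∀ᶠ y in 𝓝[closure Ω] x, ψ y ≤ η y)
    (hg : gradientWithin η (closure Ω) x = gradientWithin ψ (closure Ω) x) :
    inftyLaplacianWithin (closure Ω) ψ x ≤ inftyLaplacianWithin (closure Ω) η x := by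
  have hxK : x ∈ closure Ω := subset_closure hx
  have hK : closure Ω ∈ 𝓝 x := mem_of_superset (hΩ.mem_nhds hx) subset_closure
  have hη' := hη.contDiffAt hK
  have hψ' := hψ.contDiffAt hK
  rw [nhdsWithin_eq_nhds.2 hK] at hle
  rw [gradientWithin_eq_gradient hU hxK hη', gradientWithin_eq_gradient hU hxK hψ'] at hg
  rw [inftyLaplacianWithin_eq hU hxK hη', inftyLaplacianWithin_eq hU hxK hψ', hg]
  have hmin : IsLocalMin (fun y => η y - ψ y) x := by
    filter_upwards [hle] with y hy
    rw [heq, sub_self]; linarith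
  have h0 := hmin.fderiv_fderiv_nonneg (hη'.sub hψ') (gradient ψ x)
  have h1 : fderiv ℝ (fun y => η y - ψ y) =ᶠ[𝓝 x] fun y => fderiv ℝ η y - fderiv ℝ ψ y := by
    filter_upwards [hη'.eventually (by simp), hψ'.eventually (by simp)] with y h1 h2
    exact fderiv_fun_sub (h1.differentiableAt (by simp)) (h2.differentiableAt (by simp))
  rw [h1.fderiv_eq, fderiv_fun_sub
    ((hη'.fderiv_right (m := 1) (by norm_num)).differentiableAt (by simp))
    ((hψ'.fderiv_right (m := 1) (by norm_num)).differentiableAt (by simp))] at h0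
  simpa using h0

/-! ### The pointwise, local form of the subsolution property -/

/-- The subsolution property at the point `x` of the closure of `Ω`, tested with germs at `x`. -/
def SubAt (Ω : Set (EuclideanSpace ℝ (Fin n))) (Λ : ℝ) (u : EuclideanSpace ℝ (Fin n) → ℝ)
    (x : EuclideanSpace ℝ (Fin n)) : Prop :=
  ∀ φ : EuclideanSpace ℝ (Fin n) → ℝ, ContDiffWithinAt ℝ 2 φ (closure Ω) x → u x = φ x →
    (∀ᶠ y in 𝓝[closure Ω] x, u y ≤ φ y) → Outgoing Ω x (gradientWithin φ (closure Ω) x) →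
    signedOp Λ (φ x) ‖gradientWithin φ (closure Ω) x‖ (-inftyLaplacianWithin (closure Ω) φ x) ≤ 0

lemma opF_neg (hS : UniqueDiffOn ℝ S) (hx : x ∈ S) :
    opF Λ S (fun y => -φ y) x = -opG Λ S φ x := by
  have h1 := gradientWithin_const_sub hS hx φ 0
  have h2 := inftyLaplacianWithin_const_sub hS hx φ 0
  simp only [zero_sub] at h1 h2
  rw [opF, opG, h1, h2, norm_neg, abs_neg, ← min_neg_neg, neg_sub]

lemma opG_neg (hS : UniqueDiffOn ℝ S) (hx : x ∈ S) :
    opG Λ S (fun y => -φ y) x = -opF Λ S φ x := by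
  have h1 := gradientWithin_const_sub hS hx φ 0
  have h2 := inftyLaplacianWithin_const_sub hS hx φ 0
  simp only [zero_sub] at h1 h2
  rw [opF, opG, h1, h2, norm_neg, abs_neg, ← max_neg_neg, neg_sub]

lemma opH_neg (hS : UniqueDiffOn ℝ S) (hx : x ∈ S) :
    opH S (fun y => -φ y) x = -opH S φ x := by
  have h2 := inftyLaplacianWithin_const_sub hS hx φ 0
  simp only [zero_sub] at h2
  rw [opH, opH, h2]

lemma inner_gradientWithin_neg (hS : UniqueDiffOn ℝ S) (hx : x ∈ S)
    (ν : EuclideanSpace ℝ (Fin n)) :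
    inner ℝ (gradientWithin (fun y => -φ y) S x) ν = -inner ℝ (gradientWithin φ S x) ν := by
  have h1 := gradientWithin_const_sub hS hx φ 0
  simp only [zero_sub] at h1
  rw [h1, inner_neg_left]

lemma TouchesAbove.neg (h : TouchesAbove S u φ x) :
    TouchesBelow S (fun y => -u y) (fun y => -φ y) x :=
  ⟨h.1.neg, congrArg Neg.neg h.2.1, fun y hy hne => neg_lt_neg (h.2.2 y hy hne)⟩

lemma TouchesBelow.neg (h : TouchesBelow S u φ x) :
    TouchesAbove S (fun y => -u y) (fun y => -φ y) x :=
  ⟨h.1.neg, congrArg Neg.neg h.2.1, fun y hy hne => neg_lt_neg (h.2.2 y hy hne)⟩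

lemma IsViscositySupersolution.neg (hΩ : IsOpen Ω) (hU : UniqueDiffOn ℝ (closure Ω))
    (h : IsViscositySupersolution Ω Λ u) : IsViscositySubsolution Ω Λ fun y => -u y where
  usc := h.lsc.neg
  interior x hx φ hφ := by
    have hφ' := hφ.neg
    simp only [neg_neg] at hφ'
    obtain ⟨h1, h2, h3⟩ := h.interior x hx _ hφ'
    have hU' := hΩ.uniqueDiffOn (𝕜 := ℝ)
    rw [opF_neg hU' hx] at h1
    rw [opG_neg hU' hx] at h2
    rw [opH_neg hU' hx] at h3
    exact ⟨fun hu => neg_nonneg.1 (h2 (neg_pos.1 hu)), fun hu => neg_nonneg.1 (h1 (neg_lt_zero.1 hu)),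
      fun hu => neg_nonneg.1 (h3 (neg_eq_zero.1 hu))⟩
  boundary x hx ν hν φ hφ := by
    have hφ' := hφ.neg
    simp only [neg_neg] at hφ'
    have hxK := frontier_subset_closure hx
    obtain ⟨h1, h2, h3⟩ := h.boundary x hx ν hν _ hφ'
    rw [opF_neg hU hxK, inner_gradientWithin_neg hU hxK, max_neg_neg] at h1
    rw [opG_neg hU hxK, inner_gradientWithin_neg hU hxK, max_neg_neg] at h2
    rw [opH_neg hU hxK, inner_gradientWithin_neg hU hxK, max_neg_neg] at h3
    exact ⟨fun hu => neg_nonneg.1 (h2 (neg_pos.1 hu)), fun hu => neg_nonneg.1 (h1 (neg_lt_zero.1 hu)),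
      fun hu => neg_nonneg.1 (h3 (neg_eq_zero.1 hu))⟩

lemma IsViscositySubsolution.of_neg (hΩ : IsOpen Ω) (hU : UniqueDiffOn ℝ (closure Ω))
    (h : IsViscositySubsolution Ω Λ fun y => -u y) : IsViscositySupersolution Ω Λ u where
  lsc := by
    have h' : LowerSemicontinuousOn (fun y => - -u y) (closure Ω) := h.usc.neg
    simpa only [neg_neg] using h'
  interior x hx φ hφ := by
    obtain ⟨h1, h2, h3⟩ := h.interior x hx _ hφ.neg
    have hU' := hΩ.uniqueDiffOn (𝕜 := ℝ)
    rw [opF_neg hU' hx] at h1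
    rw [opG_neg hU' hx] at h2
    rw [opH_neg hU' hx] at h3
    exact ⟨fun hu => neg_nonpos.1 (h2 (neg_lt_zero.2 hu)), fun hu => neg_nonpos.1 (h1 (neg_pos.2 hu)),
      fun hu => neg_nonpos.1 (h3 (neg_eq_zero.2 hu))⟩
  boundary x hx ν hν φ hφ := by
    have hxK := frontier_subset_closure hx
    obtain ⟨h1, h2, h3⟩ := h.boundary x hx ν hν _ hφ.neg
    rw [opF_neg hU hxK, inner_gradientWithin_neg hU hxK, min_neg_neg] at h1
    rw [opG_neg hU hxK, inner_gradientWithin_neg hU hxK, min_neg_neg] at h2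
    rw [opH_neg hU hxK, inner_gradientWithin_neg hU hxK, min_neg_neg] at h3
    exact ⟨fun hu => neg_nonpos.1 (h2 (neg_lt_zero.2 hu)), fun hu => neg_nonpos.1 (h1 (neg_pos.2 hu)),
      fun hu => neg_nonpos.1 (h3 (neg_eq_zero.2 hu))⟩

lemma signedOp_nonpos_iff {r : ℝ} (hr : r = φ x) :
    signedOp Λ (φ x) ‖gradientWithin φ S x‖ (-inftyLaplacianWithin S φ x) ≤ 0 ↔
      (0 < r → opF Λ S φ x ≤ 0) ∧ (r < 0 → opG Λ S φ x ≤ 0) ∧ (r = 0 → opH S φ x ≤ 0) := by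
  subst hr
  rcases lt_trichotomy (φ x) 0 with h | h | h
  · rw [signedOp_of_neg h]
    simp only [h, h.not_gt, h.ne, false_imp_iff, true_and, and_true, true_imp_iff, opG]
  · simp only [h, signedOp_zero, lt_irrefl, false_imp_iff, true_and, true_imp_iff, opH]
  · rw [signedOp_of_pos h]
    simp only [h, h.not_gt, h.ne', false_imp_iff, and_true, true_imp_iff, opF]

lemma isViscositySubsolution_of_subAt (hΩ : IsOpen Ω) (hU : UniqueDiffOn ℝ (closure Ω))
    (hu : ContinuousOn u (closure Ω)) (h : ∀ x ∈ closure Ω, SubAt Ω Λ u x) :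
    IsViscositySubsolution Ω Λ u where
  usc := hu.upperSemicontinuousOn
  interior x hx φ hφ := by
    have hd : ContDiffAt ℝ 2 φ x := hφ.1.contDiffAt (hΩ.mem_nhds hx)
    have hxK := subset_closure hx
    have hU' := hΩ.uniqueDiffOn (𝕜 := ℝ)
    rw [← signedOp_nonpos_iff hφ.2.1, gradientWithin_eq_gradient hU' hx hd,
      inftyLaplacianWithin_eq hU' hx hd, ← gradientWithin_eq_gradient hU hxK hd,
      gradientWithin_eq_gradient hU hxK hd, ← inftyLaplacianWithin_eq hU hxK hd,
      ← gradientWithin_eq_gradient hU hxK hd]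
    refine h x hxK φ hd.contDiffWithinAt hφ.2.1 ?_ (outgoing_of_mem hΩ hx _)
    filter_upwards [nhdsWithin_le_nhds (hΩ.mem_nhds hx)] with y hy
    rcases eq_or_ne y x with rfl | hne
    · exact hφ.2.1.le
    · exact (hφ.2.2 y hy hne).le
  boundary x hx ν hν φ hφ := by
    have hxK := frontier_subset_closure hx
    by_cases hi : inner ℝ (gradientWithin φ (closure Ω) x) ν ≤ 0
    · exact ⟨fun _ => min_le_of_right_le hi, fun _ => min_le_of_right_le hi,
        fun _ => min_le_of_right_le hi⟩
    · have key := h x hxK φ (hφ.1 x hxK) hφ.2.1 (by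
        filter_upwards [self_mem_nhdsWithin] with y hy
        rcases eq_or_ne y x with rfl | hne
        · exact hφ.2.1.le
        · exact (hφ.2.2 y hy hne).le) (hν.outgoing (not_le.1 hi))
      obtain ⟨h1, h2, h3⟩ := (signedOp_nonpos_iff hφ.2.1).1 key
      exact ⟨fun hu => min_le_of_left_le (h1 hu), fun hu => min_le_of_left_le (h2 hu),
        fun hu => min_le_of_left_le (h3 hu)⟩

/-- A germ touching from above extends to a global strictly touching test function. -/
lemma exists_touchesAbove (hU : UniqueDiffOn ℝ (closure Ω)) (hx : x ∈ closure Ω) {C : ℝ}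
    (hC : ∀ y ∈ closure Ω, u y < C) (hφ : ContDiffWithinAt ℝ 2 φ (closure Ω) x)
    (heq : u x = φ x) (hle : ∀ᶠ y in 𝓝[closure Ω] x, u y ≤ φ y) :
    ∃ ψ, TouchesAbove (closure Ω) u ψ x ∧ ψ x = φ x ∧
      gradientWithin ψ (closure Ω) x = gradientWithin φ (closure Ω) x ∧
      inftyLaplacianWithin (closure Ω) ψ x = inftyLaplacianWithin (closure Ω) φ x := by
  have hev := hφ.eventually (by simp)
  rw [insert_eq_of_mem hx] at hev
  obtain ⟨r, hr, hball⟩ := Metric.mem_nhdsWithin_iff.1 (hev.and hle)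
  let χ : ContDiffBump x := ⟨r / 4, r / 2, by positivity, by linarith⟩
  -- Interpolates between `φ + ‖y - x‖ ^ 4` near `x` and the constant `C > u` far away; away from
  -- `x` both lie strictly above `u` wherever they are used.
  set ψ : EuclideanSpace ℝ (Fin n) → ℝ :=
    fun y => χ y * (φ y + ‖y - x‖ ^ 4) + (1 - χ y) * C with hψ
  have hnear : ψ =ᶠ[𝓝[closure Ω] x] fun y => φ y + ‖y - x‖ ^ 4 := by
    filter_upwards [nhdsWithin_le_nhds χ.eventuallyEq_one] with y hy
    simp [hψ, hy]
  have hψx : ψ x = φ x := by simpa using hnear.self_of_nhdsWithin hx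
  refine ⟨ψ, ⟨?_, heq.trans hψx.symm, ?_⟩, hψx, ?_, ?_⟩
  · intro y hy
    have hχ : ContDiffWithinAt ℝ 2 χ (closure Ω) y := χ.contDiff.contDiffAt.contDiffWithinAt
    by_cases hyr : y ∈ ball x r
    · have h1 : ContDiffWithinAt ℝ 2 φ (closure Ω) y := (hball ⟨hyr, hy⟩).1
      exact (hχ.mul (h1.add (contDiff_norm_sub_pow_four x).contDiffWithinAt)).add
        ((contDiffWithinAt_const.sub hχ).mul contDiffWithinAt_const)
    · have hfar : ψ =ᶠ[𝓝 y] fun _ => C := by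
        have : {z | r / 2 < dist z x} ∈ 𝓝 y := by
          refine (isOpen_lt continuous_const (by fun_prop)).mem_nhds ?_
          rw [mem_ball, not_lt] at hyr
          change r / 2 < dist y x
          linarith
        filter_upwards [this] with z hz
        have : χ z = 0 := χ.zero_of_le_dist (le_of_lt hz)
        simp [hψ, this]
      exact (contDiffAt_const.congr_of_eventuallyEq hfar).contDiffWithinAt
  · intro y hy hne
    have h0 : 0 ≤ χ y := χ.nonneg
    have h1 : χ y ≤ 1 := χ.le_one
    have hC' := hC y hy
    by_cases hyr : y ∈ ball x r
    · have h2 : u y ≤ φ y := (hball ⟨hyr, hy⟩).2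
      have h3 : 0 < ‖y - x‖ ^ 4 := by
        have := norm_pos_iff.2 (sub_ne_zero.2 hne)
        positivity
      have h4 : u y < φ y + ‖y - x‖ ^ 4 := by linarith
      simp only [hψ]
      rcases h1.eq_or_lt with h1 | h1
      · rw [h1]; linarith
      · nlinarith [mul_le_mul_of_nonneg_left h4.le h0, mul_lt_mul_of_pos_left hC' (sub_pos.2 h1)]
    · have : χ y = 0 := by
        refine χ.zero_of_le_dist ?_
        rw [mem_ball, not_lt] at hyr
        change r / 2 ≤ _
        linarith
      simpa [hψ, this] using hC'
  · rw [gradientWithin_congr hnear hx, gradientWithin_add_quartic hU hx hφ]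
  · rw [inftyLaplacianWithin_congr hnear hx, inftyLaplacianWithin_add_quartic hU hx hφ]

/-- At a boundary point an outgoing gradient has positive normal derivative, which rules out the
Neumann alternative and leaves the equation. -/
lemma IsViscositySubsolution.subAt (hΩ : IsOpen Ω) (hc : Convex ℝ Ω)
    (hU : UniqueDiffOn ℝ (closure Ω)) (hs : HasSmoothBoundary Ω)
    (hb : Bornology.IsBounded Ω) (hu : ContinuousOn u (closure Ω))
    (h : IsViscositySubsolution Ω Λ u) (hx : x ∈ closure Ω) : SubAt Ω Λ u x := by
  intro φ hφ heq hle hout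
  obtain ⟨C, hC⟩ := (hb.isCompact_closure.image_of_continuousOn hu).bddAbove
  obtain ⟨ψ, hψ, hψx, hg, hl⟩ := exists_touchesAbove hU hx (C := C + 1)
    (fun y hy => (hC (mem_image_of_mem u hy)).trans_lt (lt_add_one C)) hφ heq hle
  rw [← hψx, ← hg, ← hl]
  rw [← hg] at hout
  by_cases hxΩ : x ∈ Ω
  · have hψΩ : TouchesAbove Ω u ψ x :=
      ⟨hψ.1.mono subset_closure, hψ.2.1, fun y hy => hψ.2.2 y (subset_closure hy)⟩
    have hd : ContDiffAt ℝ 2 ψ x := hψΩ.1.contDiffAt (hΩ.mem_nhds hxΩ)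
    have hU' := hΩ.uniqueDiffOn (𝕜 := ℝ)
    have key := (signedOp_nonpos_iff hψΩ.2.1).2 (h.interior x hxΩ ψ hψΩ)
    rwa [gradientWithin_eq_gradient hU' hxΩ hd, inftyLaplacianWithin_eq hU' hxΩ hd,
      ← inftyLaplacianWithin_eq hU hx hd, ← gradientWithin_eq_gradient hU hx hd] at key
  · have hxf : x ∈ frontier Ω := by
      rw [hΩ.frontier_eq]; exact ⟨hx, hxΩ⟩
    obtain ⟨ν, hν⟩ := hs.exists_normal hxf
    have hpos := hν.inner_pos_of_outgoing hΩ hc hout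
    obtain ⟨h1, h2, h3⟩ := h.boundary x hxf ν hν ψ hψ
    refine (signedOp_nonpos_iff hψ.2.1).2 ⟨fun hu => ?_, fun hu => ?_, fun hu => ?_⟩
    · exact (min_le_iff.1 (h1 hu)).resolve_right hpos.not_ge
    · exact (min_le_iff.1 (h2 hu)).resolve_right hpos.not_ge
    · exact (min_le_iff.1 (h3 hu)).resolve_right hpos.not_ge

/-! ### The Lipschitz estimate for subsolutions -/

/-- Comparison with the cone of slope `Λ M` and vertex `z`. -/
lemma le_add_mul_norm_of_subAt (hU : UniqueDiffOn ℝ (closure Ω)) (hb : Bornology.IsBounded Ω)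
    (hΛ : 0 ≤ Λ) (hv : ContinuousOn v (closure Ω)) {M : ℝ} (hM0 : 0 ≤ M)
    (hM : ∀ x ∈ closure Ω, v x ≤ M) {z : EuclideanSpace ℝ (Fin n)} (hz : z ∈ Ω)
    (hsub : ∀ x ∈ closure Ω, v z < v x → SubAt Ω Λ v x) (hx : x ∈ closure Ω) :
    v x ≤ v z + Λ * M * ‖x - z‖ := by
  by_contra! hlt
  obtain ⟨R, hR0, hR⟩ : ∃ R : ℝ, 0 < R ∧ ∀ y ∈ closure Ω, ‖y - z‖ ≤ R := by
    obtain ⟨R, hR⟩ := (isBounded_iff_subset_closedBall z).1 hb.closure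
    refine ⟨max R 1, by positivity, fun y hy => ?_⟩
    rw [← dist_eq_norm]
    exact (mem_closedBall.1 (hR hy)).trans (le_max_left _ _)
  obtain ⟨ε, hε, hεlt⟩ : ∃ ε : ℝ, 0 < ε ∧ ε * R < v x - v z - Λ * M * ‖x - z‖ := by
    refine ⟨(v x - v z - Λ * M * ‖x - z‖) / (2 * R), ?_, ?_⟩
    · exact div_pos (by linarith) (by positivity)
    · have : (v x - v z - Λ * M * ‖x - z‖) / (2 * R) * R = (v x - v z - Λ * M * ‖x - z‖) / 2 := by
        field_simp
      linarith
  -- As `δ R = ε / 4`, the bent cone has slope at least `Λ M + ε / 2` throughout the closure.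
  set k := Λ * M + ε with hk
  set δ := ε / (4 * R) with hδ
  have hδ0 : 0 < δ := by positivity
  have hδR : δ * R = ε / 4 := by rw [hδ]; field_simp
  have hΛM : 0 ≤ Λ * M := mul_nonneg hΛ hM0
  set φ : EuclideanSpace ℝ (Fin n) → ℝ := fun y => v z + k * ‖y - z‖ - δ * ‖y - z‖ ^ 2 with hφ
  have hφc : Continuous φ := by fun_prop
  obtain ⟨m, hm, hmax⟩ := hb.isCompact_closure.exists_isMaxOn ⟨x, hx⟩ (hv.sub hφc.continuousOn)
  have hmax' : ∀ y ∈ closure Ω, v y - φ y ≤ v m - φ m := fun y hy => hmax hy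
  have hpos : 0 < v m - φ m := by
    refine lt_of_lt_of_le ?_ (hmax' x hx)
    have h1 := mul_le_mul_of_nonneg_left (hR x hx) hε.le
    have h2 : 0 ≤ δ * ‖x - z‖ ^ 2 := by positivity
    simp only [hφ, hk]
    nlinarith
  have hmz : m ≠ z := by
    rintro rfl
    simp [hφ] at hpos
  set r := ‖m - z‖ with hr
  have hr0 : 0 < r := norm_pos_iff.2 (sub_ne_zero.2 hmz)
  have hδr : δ * r ≤ ε / 4 := hδR ▸ mul_le_mul_of_nonneg_left (hR m hm) hδ0.le
  have hslope : Λ * M < k - 2 * δ * r := by simp only [hk]; linarith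
  -- The contact point lies above the vertex value, so the subsolution property is needed only
  -- there; this later allows the exceptional point `b`.
  have hvm : v z < v m := by
    have h1 : 0 < r * (k - δ * r) := mul_pos hr0 (by simp only [hk]; linarith)
    have h2 : φ m = v z + r * (k - δ * r) := by simp only [hφ, hr]; ring
    linarith
  have hd : ContDiffAt ℝ 2 φ m := contDiffAt_radial (v z) k δ hmz
  have key := hsub m hm hvm (fun y => φ y + (v m - φ m))
    (hd.add contDiffAt_const).contDiffWithinAt (by ring) (by
      filter_upwards [self_mem_nhdsWithin] with y hy
      have := hmax' y hy
      linarith)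
  have hgrad : gradient φ m = (k / r - 2 * δ) • (m - z) := gradient_radial (v z) k δ hmz
  have hnorm : ‖gradient φ m‖ = |k - 2 * δ * r| := norm_gradient_radial (v z) k δ hmz
  have hlap : fderiv ℝ (fderiv ℝ φ) m (gradient φ m) (gradient φ m) =
    -(2 * δ) * (k - 2 * δ * r) ^ 2 := inftyLaplacian_radial (v z) k δ hmz
  rw [gradientWithin_add_const, inftyLaplacianWithin_add_const,
    gradientWithin_eq_gradient hU hm hd, inftyLaplacianWithin_eq hU hm hd, hnorm, hlap,
    abs_of_pos (hΛM.trans_lt hslope), add_sub_cancel] at key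
  refine (key ?_).not_gt (signedOp_pos ?_ fun _ => ?_)
  · have hcoef : k / r - 2 * δ = (k - 2 * δ * r) / r := by field_simp
    have hcpos : 0 < k / r - 2 * δ := by
      rw [hcoef]; exact div_pos (hΛM.trans_lt hslope) hr0
    -- Following the negative gradient from `m` for this time leads exactly to `z ∈ Ω`.
    refine ⟨(k / r - 2 * δ)⁻¹, inv_pos.2 hcpos, ?_⟩
    rw [hgrad, smul_smul, inv_mul_cancel₀ hcpos.ne', one_smul, sub_sub_cancel]
    exact hz
  · have := pow_pos (hΛM.trans_lt hslope) 2
    have := mul_pos (mul_pos two_pos hδ0) this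
    linarith
  · exact (mul_le_mul_of_nonneg_left (hM m hm) hΛ).trans_lt hslope

/-- The cone comparison needs its vertex in `Ω` for the gradient to be outgoing; continuity then
admits vertices on the boundary. -/
lemma le_add_mul_norm_of_mem_closure (hv : ContinuousOn v (closure Ω)) {L : ℝ}
    (h : ∀ z ∈ Ω, v x ≤ v z + L * ‖x - z‖) {z : EuclideanSpace ℝ (Fin n)}
    (hz : z ∈ closure Ω) : v x ≤ v z + L * ‖x - z‖ := by
  have : (𝓝[Ω] z).NeBot := mem_closure_iff_nhdsWithin_neBot.1 hz
  have h1 : Tendsto v (𝓝[Ω] z) (𝓝 (v z)) := (hv z hz).mono subset_closure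
  have h2 : Tendsto (fun y => ‖x - y‖) (𝓝[Ω] z) (𝓝 ‖x - z‖) := by
    have : Continuous fun y => ‖x - y‖ := by fun_prop
    exact this.continuousWithinAt
  refine ge_of_tendsto (h1.add (h2.const_mul L)) ?_
  filter_upwards [self_mem_nhdsWithin] with y hy using h y hy

/-! ### The lower bound for the eigenvalue -/

lemma two_le_mul_diam (hΩ : IsOpen Ω) (hne : Ω.Nonempty) (hc : Convex ℝ Ω)
    (hs : HasSmoothBoundary Ω) (hb : Bornology.IsBounded Ω) (hΛ : 0 ≤ Λ)
    (hu : IsViscositySolution Ω Λ u) (hnc : NonconstantOn Ω u) : 2 ≤ Λ * diam Ω := by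
  have hU := uniqueDiffOn_closure hΩ hc hne
  have hK := hb.isCompact_closure
  have hKne := hne.mono subset_closure
  obtain ⟨p, hp, hmax⟩ := hK.exists_isMaxOn hKne hu.continuousOn
  obtain ⟨q, hq, hmin⟩ := hK.exists_isMinOn hKne hu.continuousOn
  have hmax' : ∀ y ∈ closure Ω, u y ≤ u p := fun y hy => hmax hy
  have hmin' : ∀ y ∈ closure Ω, u q ≤ u y := fun y hy => hmin hy
  have hlt : u q < u p := by
    obtain ⟨x, hx, y, hy, hxy⟩ := hnc
    rcases hxy.lt_or_gt with h | h
    · exact (hmin' x (subset_closure hx)).trans_lt (h.trans_le (hmax' y (subset_closure hy)))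
    · exact (hmin' y (subset_closure hy)).trans_lt (h.trans_le (hmax' x (subset_closure hx)))
  have hdist : ‖p - q‖ ≤ diam Ω := by
    rw [← dist_eq_norm, ← Metric.diam_closure]
    exact dist_le_diam_of_mem hb.closure hp hq
  have hneg : ContinuousOn (fun y => -u y) (closure Ω) := hu.continuousOn.neg
  have h1 : u p ≤ u q + Λ * max (u p) 0 * ‖p - q‖ :=
    le_add_mul_norm_of_mem_closure hu.continuousOn (fun z hz =>
      le_add_mul_norm_of_subAt hU hb hΛ hu.continuousOn (le_max_right _ _)
        (fun y hy => (hmax' y hy).trans (le_max_left _ _)) hz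
        (fun y hy _ => hu.sub.subAt hΩ hc hU hs hb hu.continuousOn hy) hp) hq
  have h2 : -u q ≤ -u p + Λ * max (-u q) 0 * ‖q - p‖ :=
    le_add_mul_norm_of_mem_closure hneg (fun z hz =>
      le_add_mul_norm_of_subAt hU hb hΛ hneg (le_max_right _ _)
        (fun y hy => (neg_le_neg (hmin' y hy)).trans (le_max_left _ _)) hz
        (fun y hy _ => (hu.super.neg hΩ hU).subAt hΩ hc hU hs hb hneg hy) hq) hp
  rw [norm_sub_rev] at h2
  -- If the positive part vanished, the cone would have slope zero and give `u p ≤ u q`.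
  have hp0 : 0 < u p := by
    by_contra! h0
    rw [max_eq_right h0] at h1
    simp at h1
    linarith
  have hq0 : 0 < -u q := by
    by_contra! h0
    rw [max_eq_right h0] at h2
    simp at h2
    linarith
  rw [max_eq_left hp0.le] at h1
  rw [max_eq_left hq0.le] at h2
  have h1' : Λ * u p * ‖p - q‖ ≤ Λ * diam Ω * u p := by
    have := mul_le_mul_of_nonneg_left hdist (mul_nonneg hΛ hp0.le)
    linarith
  have h2' : Λ * -u q * ‖p - q‖ ≤ Λ * diam Ω * -u q := by
    have := mul_le_mul_of_nonneg_left hdist (mul_nonneg hΛ hq0.le)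
    linarith
  rcases le_total (u p) (-u q) with h | h
  · refine le_of_mul_le_mul_right ?_ hp0
    linarith
  · refine le_of_mul_le_mul_right ?_ hq0
    linarith

/-! ### Extremal points and cones -/

/-- A test function above the cone has derivative at least `-Λ|p|` along `-p`, where `p` is its
gradient. Thus `|p|² ≤ Λ|p|`, so `|p| ≤ Λ`, the gradient bound at value `1`. -/
lemma subAt_of_peak (hc : Convex ℝ Ω) (ha : a ∈ closure Ω) (hΛ : 0 ≤ Λ) (hwa : w a = 1)
    (hw : ∀ y ∈ closure Ω, 1 - Λ * ‖y - a‖ ≤ w y) : SubAt Ω Λ w a := by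
  intro φ hφ heq hle hout
  set p := gradientWithin φ (closure Ω) a with hp
  have hmem := hout.eventually_mem hc ha
  have h1 := le_fderivWithin_of_eventually_le (c := -(Λ * ‖p‖))
    (hφ.differentiableWithinAt (by simp)) hmem (by
      filter_upwards [(tendsto_add_smul_nhdsWithin hmem).eventually hle, hmem,
        self_mem_nhdsWithin] with t h1 h2 h3
      have h4 := hw _ h2
      rw [add_sub_cancel_left, norm_smul, norm_neg, Real.norm_eq_abs,
        abs_of_pos (show (0 : ℝ) < t from h3)] at h4
      linarith)
  rw [← inner_gradientWithin_left, ← hp, inner_neg_right, real_inner_self_eq_norm_sq] at h1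
  have h2 : ‖p‖ ≤ Λ := by
    rcases (norm_nonneg p).eq_or_lt with h0 | h0
    · rwa [← h0]
    · nlinarith
  rw [← heq, hwa, signedOp_of_pos one_pos]
  refine min_le_of_left_le ?_
  simpa using h2

/-- Vacuous: the cone from `b` forces `⟨p, b - a⟩ ≥ 2` for the gradient `p` of a test function. A
point `a - t p` would then be farther from `b` than `a`, whose distance is maximal, so `p` is never
outgoing. -/
lemma subAt_of_antipodal (hc : Convex ℝ Ω) (ha : a ∈ closure Ω) (hb : b ∈ closure Ω) (hΛ : 0 < Λ)
    (hab : Λ * ‖a - b‖ = 2) (hd : ∀ y ∈ closure Ω, Λ * ‖y - b‖ ≤ 2) (hwa : w a = -1)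
    (hw : ∀ y ∈ closure Ω, 1 - Λ * ‖y - b‖ ≤ w y) : SubAt Ω Λ w a := by
  intro φ hφ heq hle ⟨t, ht, hat⟩
  exfalso
  set p := gradientWithin φ (closure Ω) a with hp
  have hmem : ∀ᶠ t : ℝ in 𝓝[>] 0, a + t • (b - a) ∈ closure Ω := by
    filter_upwards [Ioc_mem_nhdsGT one_pos] with t ht
    exact hc.closure.add_smul_sub_mem ha hb ⟨ht.1.le, ht.2⟩
  have h1 := le_fderivWithin_of_eventually_le (c := 2)
    (hφ.differentiableWithinAt (by simp)) hmem (by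
      filter_upwards [(tendsto_add_smul_nhdsWithin hmem).eventually hle, hmem,
        Ioc_mem_nhdsGT one_pos] with t h1 h2 h3
      have h4 := hw _ h2
      have e : a + t • (b - a) - b = (1 - t) • (a - b) := by module
      rw [e, norm_smul, Real.norm_eq_abs, abs_of_nonneg (sub_nonneg.2 h3.2), mul_left_comm,
        hab] at h4
      linarith)
  rw [← inner_gradientWithin_left, ← hp] at h1
  have h2 : ‖a - t • p - b‖ ≤ ‖a - b‖ :=
    le_of_mul_le_mul_left ((hd _ (subset_closure hat)).trans hab.ge) hΛ
  have h3 : a - t • p - b = (a - b) - t • p := by module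
  have h4 : ‖(a - b) - t • p‖ ^ 2 = ‖a - b‖ ^ 2 + 2 * t * inner ℝ p (b - a) + ‖t • p‖ ^ 2 := by
    rw [norm_sub_sq_real, inner_smul_right, real_inner_comm, ← neg_sub b a, inner_neg_right,
      norm_neg]
    ring
  have h5 : ‖(a - b) - t • p‖ ^ 2 ≤ ‖a - b‖ ^ 2 := by
    rw [← h3]; gcongr
  nlinarith [sq_nonneg ‖t • p‖, mul_pos ht (two_pos.trans_le h1)]

/-- Off the vertex the cone's gradient points towards `a`, hence not outward, so an admissible test
function touches only in the interior and shares this gradient, of norm `Λ`. The cone is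
`∞`-harmonic there, and where it is negative its values `≥ -1` give `Λ|w| - Λ ≤ 0`. -/
lemma subAt_cone (hΩ : IsOpen Ω) (hc : Convex ℝ Ω) (hU : UniqueDiffOn ℝ (closure Ω))
    (ha : a ∈ closure Ω) (hΛ : 0 < Λ) (hd : ∀ y ∈ closure Ω, Λ * ‖y - a‖ ≤ 2)
    (hx : x ∈ closure Ω) : SubAt Ω Λ (fun y => 1 - Λ * ‖y - a‖) x := by
  rcases eq_or_ne x a with rfl | hne
  · exact subAt_of_peak hc hx hΛ.le (by simp) fun _ _ => le_rfl
  intro φ hφ heq hle hout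
  set ψ : EuclideanSpace ℝ (Fin n) → ℝ := fun y => 1 + -Λ * ‖y - a‖ - 0 * ‖y - a‖ ^ 2 with hψ
  have hψe : ψ = fun y => 1 - Λ * ‖y - a‖ := by ext y; simp only [hψ]; ring
  have hψd : ContDiffAt ℝ 2 ψ x := contDiffAt_radial 1 (-Λ) 0 hne
  have hr : 0 < ‖x - a‖ := norm_pos_iff.2 (sub_ne_zero.2 hne)
  have hgrad : gradient ψ x = (-Λ / ‖x - a‖ - 2 * 0) • (x - a) := gradient_radial 1 (-Λ) 0 hne
  have hnorm : ‖gradient ψ x‖ = |-Λ - 2 * 0 * ‖x - a‖| := norm_gradient_radial 1 (-Λ) 0 hne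
  have hlap : fderiv ℝ (fderiv ℝ ψ) x (gradient ψ x) (gradient ψ x) =
    -(2 * 0) * (-Λ - 2 * 0 * ‖x - a‖) ^ 2 := inftyLaplacian_radial 1 (-Λ) 0 hne
  have heq' : ψ x = φ x := by rw [hψe]; exact heq
  have hle' : ∀ᶠ y in 𝓝[closure Ω] x, ψ y ≤ φ y := by rw [hψe]; exact hle
  obtain ⟨hxΩ, hg⟩ := gradientWithin_eq_of_touch hΩ hc hx (hφ.differentiableWithinAt (by simp))
    (hψd.differentiableAt (by simp)).differentiableWithinAt hU heq' hle' hout (by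
      refine ⟨‖x - a‖ / Λ, by positivity, ?_⟩
      rw [gradientWithin_eq_gradient hU hx hψd, hgrad, smul_smul]
      have : ‖x - a‖ / Λ * (-Λ / ‖x - a‖ - 2 * 0) = -1 := by field_simp; simp
      rw [this]
      convert ha using 1
      module)
  have hl := inftyLaplacianWithin_le_of_touch hΩ hxΩ hU hφ hψd.contDiffWithinAt heq' hle' hg
  rw [inftyLaplacianWithin_eq hU hx hψd, hlap] at hl
  have hl' : -inftyLaplacianWithin (closure Ω) φ x ≤ 0 := by linarith
  refine (signedOp_mono Λ _ _ hl').trans ?_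
  rw [hg, gradientWithin_eq_gradient hU hx hψd, hnorm, mul_zero, zero_mul, sub_zero, abs_neg,
    abs_of_pos hΛ, ← heq]
  change signedOp Λ (1 - Λ * ‖x - a‖) Λ 0 ≤ 0
  have hdx := hd x hx
  rcases lt_trichotomy (1 - Λ * ‖x - a‖) 0 with h | h | h
  · rw [signedOp_of_neg h, abs_of_neg h]
    refine max_le ?_ le_rfl
    nlinarith
  · rw [h, signedOp_zero]
  · rw [signedOp_of_pos h]
    exact min_le_right _ _

/-! ### Stability and the bump construction -/

/-- A strict violation is stable under moving the point and, through `c`, under shifting the test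
function vertically to a new contact value. -/
lemma exists_radius_signedOp_pos (hΩ : IsOpen Ω) (hU : UniqueDiffOn ℝ (closure Ω))
    (hx : x ∈ closure Ω) (hφ : ContDiffWithinAt ℝ 2 φ (closure Ω) x)
    (hout : Outgoing Ω x (gradientWithin φ (closure Ω) x))
    (hpos : 0 < signedOp Λ (φ x) ‖gradientWithin φ (closure Ω) x‖
      (-inftyLaplacianWithin (closure Ω) φ x)) :
    ∃ r > 0, ∀ y ∈ closure Ω, dist y x < r → ContDiffWithinAt ℝ 2 φ (closure Ω) y ∧
      Outgoing Ω y (gradientWithin φ (closure Ω) y) ∧ ∀ c : ℝ, |c| < r →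
      0 < signedOp Λ (φ y + c) ‖gradientWithin φ (closure Ω) y‖
        (-inftyLaplacianWithin (closure Ω) φ y) := by
  have hev := hφ.eventually (by simp)
  rw [insert_eq_of_mem hx] at hev
  have hgc := continuousWithinAt_gradientWithin hU hx hφ
  have hlc := continuousWithinAt_inftyLaplacianWithin hU hx hφ
  have hout' := hout.eventually_nhdsWithin hΩ hgc
  have hop : ∀ᶠ q : EuclideanSpace ℝ (Fin n) × ℝ in 𝓝[closure Ω] x ×ˢ 𝓝 0,
      0 < signedOp Λ (φ q.1 + q.2) ‖gradientWithin φ (closure Ω) q.1‖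
        (-inftyLaplacianWithin (closure Ω) φ q.1) := by
    refine eventually_signedOp_pos (r := φ x) ?_ (hgc.norm.tendsto.comp tendsto_fst)
      (hlc.neg.tendsto.comp tendsto_fst) (norm_nonneg _) (fun h0 => ?_) hpos
    · have := (hφ.continuousWithinAt.tendsto.comp
        (tendsto_fst (f := 𝓝[closure Ω] x) (g := 𝓝 (0 : ℝ)))).add tendsto_snd
      simpa using this
    · rw [norm_eq_zero] at h0
      change -inftyLaplacianWithin (closure Ω) φ x = 0
      rw [inftyLaplacianWithin, h0, map_zero, neg_zero]
  obtain ⟨A, hA, B, hB, hAB⟩ := eventually_prod_iff.1 hop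
  obtain ⟨r₁, hr₁, h₁⟩ := Metric.mem_nhdsWithin_iff.1 ((hev.and hout').and hA)
  obtain ⟨r₂, hr₂, h₂⟩ := Metric.eventually_nhds_iff.1 hB
  refine ⟨min r₁ r₂, lt_min hr₁ hr₂, fun y hy hyx => ?_⟩
  have h3 := h₁ ⟨mem_ball.2 (hyx.trans_le (min_le_left _ _)), hy⟩
  refine ⟨h3.1.1, h3.1.2, fun c hc => hAB h3.2 (h₂ ?_)⟩
  rw [Real.dist_eq, sub_zero]
  exact hc.trans_le (min_le_right _ _)

/-- A function approximated from below at `x` by subsolutions is a subsolution at `x`. -/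
lemma subAt_of_approx (hΩ : IsOpen Ω) (hU : UniqueDiffOn ℝ (closure Ω))
    (hb : Bornology.IsBounded Ω) (hx : x ∈ closure Ω) (hxb : x ≠ b)
    (h : ∀ ε > 0, ∃ v, ContinuousOn v (closure Ω) ∧ (∀ y ∈ closure Ω, v y ≤ u y) ∧
      u x - ε < v x ∧ ∀ y ∈ closure Ω, y ≠ b → SubAt Ω Λ v y) : SubAt Ω Λ u x := by
  intro φ hφ heq hle hout
  by_contra! hpos
  set φ' : EuclideanSpace ℝ (Fin n) → ℝ := fun y => φ y + ‖y - x‖ ^ 4 with hφ'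
  have hφd : ContDiffWithinAt ℝ 2 φ' (closure Ω) x :=
    hφ.add (contDiff_norm_sub_pow_four x).contDiffWithinAt
  have hφx : φ' x = φ x := by simp [hφ']
  rw [← gradientWithin_add_quartic hU hx hφ] at hout
  rw [← gradientWithin_add_quartic hU hx hφ, ← inftyLaplacianWithin_add_quartic hU hx hφ,
    ← hφx] at hpos
  obtain ⟨r₁, hr₁, h₁⟩ := exists_radius_signedOp_pos hΩ hU hx hφd hout hpos
  obtain ⟨r₂, hr₂, h₂⟩ := Metric.mem_nhdsWithin_iff.1 hle
  obtain ⟨s, hs, hs1, hs2, hs3⟩ : ∃ s : ℝ, 0 < s ∧ s < r₁ ∧ s < r₂ ∧ s < dist x b := by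
    obtain ⟨s, hs, hs'⟩ := exists_between (lt_min hr₁ (lt_min hr₂ (dist_pos.2 hxb)))
    simp only [lt_min_iff] at hs'
    exact ⟨s, hs, hs'⟩
  -- An error below `s ^ 4` keeps the maximum point of `v - φ'` inside the ball of radius `s`,
  -- thanks to the quartic term; an error below `r₁` makes the vertical shift admissible.
  obtain ⟨v, hvc, hvu, hvx, hvs⟩ := h (min r₁ (s ^ 4)) (lt_min hr₁ (by positivity))
  have hcomp : IsCompact (closure Ω ∩ closedBall x s) :=
    hb.isCompact_closure.inter_right isClosed_closedBall
  have hcont : ContinuousOn (fun y => v y - φ' y) (closure Ω ∩ closedBall x s) := by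
    refine (hvc.mono inter_subset_left).sub fun y hy => ?_
    exact ((h₁ y hy.1 ((mem_closedBall.1 hy.2).trans_lt hs1)).1.continuousWithinAt).mono
      inter_subset_left
  obtain ⟨m, ⟨hmK, hms⟩, hmax⟩ := hcomp.exists_isMaxOn
    ⟨x, hx, mem_closedBall_self hs.le⟩ hcont
  have hmax' : ∀ y ∈ closure Ω, dist y x ≤ s → v y - φ' y ≤ v m - φ' m :=
    fun y hy hy' => hmax (show y ∈ closure Ω ∩ closedBall x s from ⟨hy, hy'⟩)
  rw [mem_closedBall] at hms
  have hlow : -min r₁ (s ^ 4) < v m - φ' m := by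
    have := hmax' x hx (by simpa using hs.le)
    linarith
  have hup : v m - φ' m ≤ -dist m x ^ 4 := by
    have h3 : u m ≤ φ m := h₂ ⟨mem_ball.2 (hms.trans_lt hs2), hmK⟩
    have h4 := hvu m hmK
    simp only [hφ', dist_eq_norm]
    linarith
  have hms' : dist m x < s := by
    refine lt_of_pow_lt_pow_left₀ 4 hs.le ?_
    have := min_le_right r₁ (s ^ 4)
    linarith
  have hmb : m ≠ b := by
    rintro rfl
    rw [dist_comm] at hs3
    linarith
  obtain ⟨hmd, hmo, hmop⟩ := h₁ m hmK (hms'.trans hs1)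
  have key := hvs m hmK hmb (fun y => φ' y + (v m - φ' m)) (hmd.add contDiffWithinAt_const)
    (by ring) (by
      filter_upwards [self_mem_nhdsWithin, nhdsWithin_le_nhds (ball_mem_nhds m (sub_pos.2 hms'))]
        with y hy hy'
      have h3 : dist y x ≤ s := by
        have := dist_triangle y m x
        rw [mem_ball] at hy'
        linarith
      have := hmax' y hy h3
      linarith)
  rw [gradientWithin_add_const, inftyLaplacianWithin_add_const] at key
  refine (key hmo).not_gt (hmop _ ?_)
  rw [abs_lt]
  have h5 := min_le_left r₁ (s ^ 4)
  have h6 : 0 ≤ dist m x ^ 4 := by positivity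
  constructor <;> linarith

/-- Where `-u` is not a subsolution, `u` can be increased locally as a subsolution. -/
lemma exists_bump (hΩ : IsOpen Ω) (hc : Convex ℝ Ω) (hU : UniqueDiffOn ℝ (closure Ω))
    (hx : x ∈ closure Ω) (hu : ContinuousOn u (closure Ω))
    (h : ¬ SubAt Ω Λ (fun y => -u y) x) {ε : ℝ} (hε : 0 < ε) :
    ∃ w, ContinuousOn w (closure Ω) ∧ (∀ y ∈ closure Ω, u y ≤ w y) ∧ u x < w x ∧
      (∀ y ∈ closure Ω, w y ≤ u y + ε) ∧ (∀ y, ε ≤ dist y x → w y = u y) ∧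
      ∀ y ∈ closure Ω, SubAt Ω Λ u y → SubAt Ω Λ w y := by
  unfold SubAt at h
  push Not at h
  obtain ⟨φ, hφ, heq, hle, hout, hpos⟩ := h
  set φ' : EuclideanSpace ℝ (Fin n) → ℝ := fun y => φ y + ‖y - x‖ ^ 4 with hφ'
  have hφd : ContDiffWithinAt ℝ 2 φ' (closure Ω) x :=
    hφ.add (contDiff_norm_sub_pow_four x).contDiffWithinAt
  have hφx : φ' x = φ x := by simp [hφ']
  rw [← gradientWithin_add_quartic hU hx hφ] at hout
  rw [← gradientWithin_add_quartic hU hx hφ, ← inftyLaplacianWithin_add_quartic hU hx hφ,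
    ← hφx] at hpos
  obtain ⟨r₁, hr₁, h₁⟩ := exists_radius_signedOp_pos hΩ hU hx hφd hout hpos
  obtain ⟨r₂, hr₂, h₂⟩ := Metric.mem_nhdsWithin_iff.1 hle
  obtain ⟨r, hr, hrr₁, hrr₂, hrε⟩ : ∃ r : ℝ, 0 < r ∧ r ≤ r₁ ∧ r ≤ r₂ ∧ r ≤ ε :=
    ⟨min r₁ (min r₂ ε), lt_min hr₁ (lt_min hr₂ hε), min_le_left _ _,
      (min_le_right _ _).trans (min_le_left _ _), (min_le_right _ _).trans (min_le_right _ _)⟩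
  obtain ⟨s, hs, hsr⟩ := exists_between hr
  obtain ⟨δ, hδ, hδr, hδs⟩ : ∃ δ : ℝ, 0 < δ ∧ δ < r ∧ δ < s ^ 4 := by
    obtain ⟨δ, hδ, hδ'⟩ := exists_between (lt_min hr (pow_pos hs 4))
    simp only [lt_min_iff] at hδ'
    exact ⟨δ, hδ, hδ'⟩
  -- Since `u ≥ -φ` near `x`, the lift `δ < s ^ 4` puts `ψ` above `u` at `x` but below it for `s ≤
  -- dist y x < r`, so the maximum glues continuously to `u`.
  set ψ : EuclideanSpace ℝ (Fin n) → ℝ := fun y => δ - φ' y with hψ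
  have hψle : ∀ y ∈ closure Ω, dist y x < r → ψ y ≤ u y + δ - dist y x ^ 4 := by
    intro y hy hyr
    have h3 : -u y ≤ φ y := h₂ ⟨mem_ball.2 (hyr.trans_le hrr₂), hy⟩
    simp only [hψ, hφ', dist_eq_norm]
    linarith
  classical
  set w : EuclideanSpace ℝ (Fin n) → ℝ := fun y => if dist y x < s then max (u y) (ψ y) else u y
    with hw
  have hw_eq : ∀ y ∈ closure Ω, dist y x < r → w y = max (u y) (ψ y) := by
    intro y hy hyr
    by_cases hys : dist y x < s
    · simp [hw, hys]
    · simp only [hw, hys, if_false]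
      refine (max_eq_left ?_).symm
      have h3 := hψle y hy hyr
      have h4 : s ^ 4 ≤ dist y x ^ 4 := pow_le_pow_left₀ hs.le (not_lt.1 hys) 4
      linarith
  have hw_far : ∀ y, s ≤ dist y x → w y = u y := fun y hy => by simp [hw, hy.not_gt]
  have huw : ∀ y, u y ≤ w y := by
    intro y
    by_cases hys : dist y x < s
    · simp [hw, hys]
    · exact (hw_far y (not_lt.1 hys)).ge
  refine ⟨w, ?_, fun y _ => huw y, ?_, ?_, fun y hy => hw_far y (hsr.le.trans (hrε.trans hy)), ?_⟩
  · intro y hy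
    by_cases hyr : dist y x < r
    · have h3 : ContinuousWithinAt (fun z => max (u z) (ψ z)) (closure Ω) y :=
        (hu y hy).max (continuousWithinAt_const.sub
          (h₁ y hy (hyr.trans_le hrr₁)).1.continuousWithinAt)
      refine h3.congr_of_eventuallyEq_of_mem ?_ hy
      filter_upwards [self_mem_nhdsWithin,
        nhdsWithin_le_nhds (isOpen_ball.mem_nhds (mem_ball.2 hyr))] with z hz hzr
      exact hw_eq z hz hzr
    · refine (hu y hy).congr_of_eventuallyEq_of_mem ?_ hy
      have : {z | s < dist z x} ∈ 𝓝 y :=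
        (isOpen_lt continuous_const (by fun_prop)).mem_nhds (hsr.trans_le (not_lt.1 hyr))
      filter_upwards [nhdsWithin_le_nhds this] with z hz
      exact hw_far z (le_of_lt hz)
  · rw [hw_eq x hx (by simpa using hr)]
    refine lt_max_of_lt_right ?_
    simp only [hψ, hφx, ← heq]
    linarith
  · intro y hy
    by_cases hyr : dist y x < r
    · rw [hw_eq y hy hyr]
      have h3 := hψle y hy hyr
      have h4 : 0 ≤ dist y x ^ 4 := by positivity
      exact max_le (by linarith) (by linarith)
    · rw [hw_far y (hsr.le.trans (not_lt.1 hyr))]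
      linarith
  · intro y hy hsub η hη hηeq hηle hηout
    by_cases hwu : w y = u y
    · exact hsub η hη (hwu.symm.trans hηeq) (hηle.mono fun z hz => (huw z).trans hz) hηout
    · have hys : dist y x < s := by
        by_contra hys
        exact hwu (hw_far y (not_lt.1 hys))
      have hyr : dist y x < r := hys.trans hsr
      have hwψ : w y = ψ y := by
        rw [hw_eq y hy hyr] at hwu ⊢
        exact max_eq_right (le_of_lt (lt_of_not_ge fun hge => hwu (max_eq_left hge)))
      -- On the raised part `∇ψ = -∇φ'` with `∇φ'` outgoing, so `η` can touch only in the interior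
      -- with the same gradient; oddness of the operator turns the violation for `φ'` into the
      -- inequality for `η`.
      obtain ⟨hyd, ⟨t, ht, hyt⟩, hyop⟩ := h₁ y hy (hyr.trans_le hrr₁)
      have hψd : ContDiffWithinAt ℝ 2 ψ (closure Ω) y := contDiffWithinAt_const.sub hyd
      have hψη : ∀ᶠ z in 𝓝[closure Ω] y, ψ z ≤ η z := by
        filter_upwards [hηle, self_mem_nhdsWithin,
          nhdsWithin_le_nhds (isOpen_ball.mem_nhds (mem_ball.2 hyr))] with z h1 h2 h3
        rw [hw_eq z h2 h3] at h1
        exact (le_max_right _ _).trans h1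
      have heq' : ψ y = η y := hwψ.symm.trans hηeq
      have hgψ : gradientWithin ψ (closure Ω) y = -gradientWithin φ' (closure Ω) y :=
        gradientWithin_const_sub hU hy φ' δ
      have hlψ : inftyLaplacianWithin (closure Ω) ψ y = -inftyLaplacianWithin (closure Ω) φ' y :=
        inftyLaplacianWithin_const_sub hU hy φ' δ
      obtain ⟨hyΩ, hg⟩ := gradientWithin_eq_of_touch hΩ hc hy
        (hη.differentiableWithinAt (by simp)) (hψd.differentiableWithinAt (by simp)) hU heq' hψη
        hηout ⟨t, ht, by
          rw [hgψ, smul_neg, ← sub_eq_add_neg]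
          exact subset_closure hyt⟩
      have hl := inftyLaplacianWithin_le_of_touch hΩ hyΩ hU hη hψd heq' hψη hg
      refine (signedOp_mono Λ _ _ (neg_le_neg hl)).trans ?_
      have hval : η y = -(φ' y + -δ) := by rw [← heq']; simp only [hψ]; ring
      rw [hlψ, hg, hgψ, norm_neg, hval, signedOp_neg]
      have := hyop (-δ) (by rw [abs_neg, abs_of_pos hδ]; exact hδr.trans_le hrr₁)
      linarith

/-! ### Perron's method -/

/-- A bounded convex open set with a pair of points `a`, `b` of its closure at maximal distance,
where `Λ` is twice the inverse of that distance. -/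
structure DiametralPair (Ω : Set (EuclideanSpace ℝ (Fin n))) (Λ : ℝ)
    (a b : EuclideanSpace ℝ (Fin n)) : Prop where
  isOpen : IsOpen Ω
  convex : Convex ℝ Ω
  nonempty : Ω.Nonempty
  isBounded : Bornology.IsBounded Ω
  left_mem : a ∈ closure Ω
  right_mem : b ∈ closure Ω
  pos : 0 < Λ
  mul_norm_le : ∀ x ∈ closure Ω, ∀ y ∈ closure Ω, Λ * ‖x - y‖ ≤ 2
  mul_norm_eq : Λ * ‖a - b‖ = 2

/-- The competitors in Perron's method: subsolutions away from `b` that lie between the cone with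
vertex `a` and the constant `1`, and take the value `-1` at `b`. -/
structure IsCompetitor (Ω : Set (EuclideanSpace ℝ (Fin n))) (Λ : ℝ)
    (a b : EuclideanSpace ℝ (Fin n)) (v : EuclideanSpace ℝ (Fin n) → ℝ) : Prop where
  continuousOn : ContinuousOn v (closure Ω)
  cone_le : ∀ x ∈ closure Ω, 1 - Λ * ‖x - a‖ ≤ v x
  le_one : ∀ x ∈ closure Ω, v x ≤ 1
  apply_right : v b = -1
  subAt : ∀ x ∈ closure Ω, x ≠ b → SubAt Ω Λ v x

/-- The pointwise supremum of all competitors. -/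
noncomputable def perron (Ω : Set (EuclideanSpace ℝ (Fin n))) (Λ : ℝ)
    (a b x : EuclideanSpace ℝ (Fin n)) : ℝ :=
  sSup ((fun v : EuclideanSpace ℝ (Fin n) → ℝ => v x) '' {v | IsCompetitor Ω Λ a b v})

lemma bddAbove_competitors (hx : x ∈ closure Ω) :
    BddAbove ((fun v : EuclideanSpace ℝ (Fin n) → ℝ => v x) '' {v | IsCompetitor Ω Λ a b v}) :=
  ⟨1, forall_mem_image.2 fun _ hv => hv.le_one x hx⟩

lemma le_perron (hv : IsCompetitor Ω Λ a b v) (hx : x ∈ closure Ω) : v x ≤ perron Ω Λ a b x :=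
  le_csSup (bddAbove_competitors hx) ⟨v, hv, rfl⟩

namespace DiametralPair

lemma uniqueDiffOn (h : DiametralPair Ω Λ a b) : UniqueDiffOn ℝ (closure Ω) :=
  uniqueDiffOn_closure h.isOpen h.convex h.nonempty

lemma isCompetitor_cone (h : DiametralPair Ω Λ a b) :
    IsCompetitor Ω Λ a b fun y => 1 - Λ * ‖y - a‖ where
  continuousOn := by fun_prop
  cone_le _ _ := le_rfl
  le_one x _ := by
    have := mul_nonneg h.pos.le (norm_nonneg (x - a))
    linarith
  apply_right := by
    rw [norm_sub_rev, h.mul_norm_eq]; norm_num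
  subAt _ hx _ := subAt_cone h.isOpen h.convex h.uniqueDiffOn h.left_mem h.pos
    (fun y hy => h.mul_norm_le y hy a h.left_mem) hx

lemma neg_one_le (h : DiametralPair Ω Λ a b) (hv : IsCompetitor Ω Λ a b v) (hx : x ∈ closure Ω) : -1 ≤ v x := by
  have h1 := hv.cone_le x hx
  have h2 := h.mul_norm_le x hx a h.left_mem
  linarith

/-- The cone estimate with `M = 1`. The missing condition at `b` is harmless, since `v b = -1` is
the minimum and contact occurs strictly above the vertex value. -/
lemma competitor_le (h : DiametralPair Ω Λ a b) (hv : IsCompetitor Ω Λ a b v)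
    (hx : x ∈ closure Ω) (hy : y ∈ closure Ω) :
    v x ≤ v y + Λ * ‖x - y‖ := by
  refine le_add_mul_norm_of_mem_closure hv.continuousOn (fun z hz => ?_) hy
  have := le_add_mul_norm_of_subAt h.uniqueDiffOn h.isBounded h.pos.le hv.continuousOn zero_le_one
    hv.le_one hz (fun m hm hlt => hv.subAt m hm ?_) hx
  · rwa [mul_one] at this
  · rintro rfl
    rw [hv.apply_right] at hlt
    exact (h.neg_one_le hv (subset_closure hz)).not_gt hlt

lemma perron_le (h : DiametralPair Ω Λ a b) {c : ℝ}
    (hc : ∀ v, IsCompetitor Ω Λ a b v → v x ≤ c) : perron Ω Λ a b x ≤ c :=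
  csSup_le ⟨_, _, h.isCompetitor_cone, rfl⟩ (forall_mem_image.2 hc)

lemma perron_le_add (h : DiametralPair Ω Λ a b) (hx : x ∈ closure Ω) (hy : y ∈ closure Ω) :
    perron Ω Λ a b x ≤ perron Ω Λ a b y + Λ * ‖x - y‖ :=
  h.perron_le fun _ hv =>
    (h.competitor_le hv hx hy).trans (add_le_add_left (le_perron hv hy) _)

lemma lipschitzOnWith_perron (h : DiametralPair Ω Λ a b) :
    LipschitzOnWith Λ.toNNReal (perron Ω Λ a b) (closure Ω) := by
  refine LipschitzOnWith.of_le_add_mul _ fun x hx y hy => ?_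
  rw [Real.coe_toNNReal _ h.pos.le, dist_eq_norm]
  exact h.perron_le_add hx hy

/-- The common Lipschitz constant gives continuity, and approximation from below preserves the
subsolution property. -/
lemma isCompetitor_perron (h : DiametralPair Ω Λ a b) : IsCompetitor Ω Λ a b (perron Ω Λ a b) where
  continuousOn := h.lipschitzOnWith_perron.continuousOn
  cone_le _ hx := le_perron h.isCompetitor_cone hx
  le_one x hx := h.perron_le fun v hv => hv.le_one x hx
  apply_right := le_antisymm (h.perron_le fun v hv => hv.apply_right.le)
    (h.isCompetitor_cone.apply_right.ge.trans (le_perron h.isCompetitor_cone h.right_mem))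
  subAt x hx hxb := by
    refine subAt_of_approx h.isOpen h.uniqueDiffOn h.isBounded hx hxb fun ε hε => ?_
    obtain ⟨_, ⟨v, hv, rfl⟩, hlt⟩ := exists_lt_of_lt_csSup
      (⟨_, _, h.isCompetitor_cone, rfl⟩ : ((fun v : EuclideanSpace ℝ (Fin n) → ℝ => v x) ''
        {v | IsCompetitor Ω Λ a b v}).Nonempty) (sub_lt_self (perron Ω Λ a b x) hε)
    exact ⟨v, hv.continuousOn, fun y hy => le_perron hv hy, hlt, hv.subAt⟩

lemma subAt_perron (h : DiametralPair Ω Λ a b) (hx : x ∈ closure Ω) : SubAt Ω Λ (perron Ω Λ a b) x := by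
  rcases eq_or_ne x b with rfl | hne
  · exact subAt_of_antipodal h.convex hx h.left_mem h.pos (by rw [norm_sub_rev, h.mul_norm_eq])
      (fun y hy => h.mul_norm_le y hy a h.left_mem) h.isCompetitor_perron.apply_right
      h.isCompetitor_perron.cone_le
  · exact h.isCompetitor_perron.subAt x hx hne

lemma subAt_neg_perron (h : DiametralPair Ω Λ a b) (hx : x ∈ closure Ω) : SubAt Ω Λ (fun y => -perron Ω Λ a b y) x := by
  have hP := h.isCompetitor_perron
  have hcone : ∀ y ∈ closure Ω, 1 - Λ * ‖y - b‖ ≤ -perron Ω Λ a b y := by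
    intro y hy
    have := h.perron_le_add hy h.right_mem
    rw [hP.apply_right] at this
    linarith
  rcases eq_or_ne x b with rfl | hne
  · exact subAt_of_peak h.convex hx h.pos.le (by rw [hP.apply_right, neg_neg]) hcone
  rcases (hP.le_one x hx).eq_or_lt with h1 | h1
  · refine subAt_of_antipodal h.convex hx h.right_mem h.pos ?_
      (fun y hy => h.mul_norm_le y hy b h.right_mem) (by rw [h1]) hcone
    -- The value `1` forces `Λ‖x - b‖ ≥ 2`, so `x` is as far from `b` as possible.
    have h2 := hcone x hx
    have h3 := h.mul_norm_le x hx b h.right_mem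
    rw [h1] at h2
    linarith
  by_contra hns
  have hΛ := h.pos
  -- The bump must leave the value at `b` unchanged and stay below `1`; near `x` the raised function
  -- is at most `P x + Λ ε + ε`.
  obtain ⟨ε, hε, hεb, hε1⟩ : ∃ ε : ℝ, 0 < ε ∧ ε ≤ dist b x ∧
      perron Ω Λ a b x + Λ * ε + ε ≤ 1 := by
    refine ⟨min (dist b x) ((1 - perron Ω Λ a b x) / (Λ + 1)),
      lt_min (dist_pos.2 hne.symm) (div_pos (sub_pos.2 h1) (by linarith)), min_le_left _ _, ?_⟩
    have h2 := min_le_right (dist b x) ((1 - perron Ω Λ a b x) / (Λ + 1))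
    rw [le_div_iff₀ (by linarith)] at h2
    linarith
  obtain ⟨w, hwc, hle, hlt, hup, hfar, hsub⟩ :=
    exists_bump h.isOpen h.convex h.uniqueDiffOn hx hP.continuousOn hns hε
  refine hlt.not_ge (le_perron ?_ hx)
  refine ⟨hwc, fun y hy => (hP.cone_le y hy).trans (hle y hy), fun y hy => ?_,
    (hfar b hεb).trans hP.apply_right, fun y hy _ => hsub y hy (h.subAt_perron hy)⟩
  rcases le_or_gt ε (dist y x) with hy' | hy'
  · rw [hfar y hy']
    exact hP.le_one y hy
  · have h2 := h.perron_le_add hy hx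
    have h3 := hup y hy
    have h4 : Λ * ‖y - x‖ ≤ Λ * ε := by
      rw [← dist_eq_norm]
      exact mul_le_mul_of_nonneg_left hy'.le hΛ.le
    linarith

lemma isViscositySolution_perron (h : DiametralPair Ω Λ a b) : IsViscositySolution Ω Λ (perron Ω Λ a b) where
  continuousOn := h.isCompetitor_perron.continuousOn
  sub := isViscositySubsolution_of_subAt h.isOpen h.uniqueDiffOn h.isCompetitor_perron.continuousOn
    fun _ hx => h.subAt_perron hx
  super := (isViscositySubsolution_of_subAt h.isOpen h.uniqueDiffOn
    h.isCompetitor_perron.continuousOn.neg fun _ hx => h.subAt_neg_perron hx).of_neg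
    h.isOpen h.uniqueDiffOn

lemma nonconstantOn_perron (h : DiametralPair Ω Λ a b) : NonconstantOn Ω (perron Ω Λ a b) := by
  have hP := h.isCompetitor_perron
  by_contra hcon
  unfold NonconstantOn at hcon
  push Not at hcon
  obtain ⟨z, hz⟩ := h.nonempty
  -- Constancy on `Ω` would pass to the closure, contradicting the values at `a` and `b`.
  have hconst : ∀ x ∈ closure Ω, perron Ω Λ a b x = perron Ω Λ a b z :=
    EqOn.of_subset_closure (s := Ω) (fun x hx => hcon x hx z hz) hP.continuousOn
      continuousOn_const subset_closure Subset.rfl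
  have h1 := hP.cone_le a h.left_mem
  rw [sub_self, norm_zero, mul_zero, sub_zero, hconst a h.left_mem, ← hconst b h.right_mem,
    hP.apply_right] at h1
  linarith

end DiametralPair

lemma diam_pos (hn : 1 ≤ n) (hΩ : IsOpen Ω) (hne : Ω.Nonempty) (hb : Bornology.IsBounded Ω) :
    0 < diam Ω := by
  obtain ⟨z, hz⟩ := hne
  let e : EuclideanSpace ℝ (Fin n) := EuclideanSpace.single ⟨0, hn⟩ 1
  have he : ‖e‖ = 1 := by simp [e]
  obtain ⟨t, ht, hzt⟩ := outgoing_of_mem hΩ hz e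
  refine lt_of_lt_of_le ?_ (dist_le_diam_of_mem hb hz hzt)
  rw [dist_eq_norm, sub_sub_cancel, norm_smul, he, mul_one]
  exact norm_pos_iff.2 ht.ne'

lemma exists_diametralPair (hn : 1 ≤ n) (hΩ : IsOpen Ω) (hne : Ω.Nonempty)
    (hb : Bornology.IsBounded Ω) (hc : Convex ℝ Ω) :
    ∃ a b, DiametralPair Ω (2 / diam Ω) a b := by
  have hD := diam_pos hn hΩ hne hb
  have hK := hb.isCompact_closure
  have hKne := hne.mono subset_closure
  obtain ⟨⟨a, b⟩, ⟨ha, hb'⟩, hmax⟩ := (hK.prod hK).exists_isMaxOn (hKne.prod hKne)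
    (continuous_dist.continuousOn (s := closure Ω ×ˢ closure Ω))
  have hdle : ∀ x ∈ closure Ω, ∀ y ∈ closure Ω, dist x y ≤ diam Ω := fun x hx y hy => by
    rw [← Metric.diam_closure]
    exact dist_le_diam_of_mem hb.closure hx hy
  have hab : dist a b = diam Ω := by
    refine le_antisymm (hdle a ha b hb') ?_
    refine diam_le_of_forall_dist_le dist_nonneg fun x hx y hy => ?_
    exact isMaxOn_iff.1 hmax (x, y) ⟨subset_closure hx, subset_closure hy⟩
  refine ⟨a, b, hΩ, hc, hne, hb, ha, hb', div_pos two_pos hD, fun x hx y hy => ?_, ?_⟩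
  · rw [← dist_eq_norm, div_mul_eq_mul_div, div_le_iff₀ hD]
    exact mul_le_mul_of_nonneg_left (hdle x hx y hy) two_pos.le
  · rw [← dist_eq_norm, hab, div_mul_cancel₀ _ hD.ne']

end NeumannInfty

theorem mainTheorem1 (n : ℕ) (hn : 1 ≤ n) (Ω : Set (EuclideanSpace ℝ (Fin n)))
    (hΩ_open : IsOpen Ω) (hΩ_ne : Ω.Nonempty) (hΩ_bdd : Bornology.IsBounded Ω)
    (hΩ_conv : Convex ℝ Ω) (hΩ_smooth : NeumannInfty.HasSmoothBoundary Ω) :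
    (∀ Λ : ℝ, 0 ≤ Λ →
      (∃ u : EuclideanSpace ℝ (Fin n) → ℝ,
        NeumannInfty.IsViscositySolution Ω Λ u ∧ NeumannInfty.NonconstantOn Ω u) →
      2 / Metric.diam Ω ≤ Λ) ∧
    (∃ u : EuclideanSpace ℝ (Fin n) → ℝ,
      NeumannInfty.IsViscositySolution Ω (2 / Metric.diam Ω) u ∧
      NeumannInfty.NonconstantOn Ω u ∧
      ∃ K : NNReal, LipschitzOnWith K u (closure Ω)) := by
  refine ⟨fun Λ hΛ ⟨u, hu, hnc⟩ => ?_, ?_⟩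
  · rw [div_le_iff₀ (NeumannInfty.diam_pos hn hΩ_open hΩ_ne hΩ_bdd)]
    exact NeumannInfty.two_le_mul_diam hΩ_open hΩ_ne hΩ_conv hΩ_smooth hΩ_bdd hΛ hu hnc
  · obtain ⟨a, b, h⟩ := NeumannInfty.exists_diametralPair hn hΩ_open hΩ_ne hΩ_bdd hΩ_conv
    exact ⟨_, h.isViscositySolution_perron, h.nonconstantOn_perron, _, h.lipschitzOnWith_perron⟩
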